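/- Let $n\ge 1$ and $1<p<\infty$, $p'=p/(p-1)$. Let $\mathbb{R}^{n+1}_+=\{(x,t):x\in\mathbb{R}^n,\ t\ge 0\}$. Cubes $Q\subset\mathbb{R}^n$ have sides parallel to the axes and side length $l(Q)>0$, and $\tilde Q=\{(x,t): x\in Q,\ 0\le t<l(Q)\}$. For a weight $\sigma$ (a nonnegative locally integrable function on $\mathbb{R}^n$) put $\sigma(Q)=\int_Q\sigma\,dx$. The Poisson integral is $$Pf(x,t)=\int_{\mathbb{R}^n}f(y)\,P(x-y,t)\,dy,\qquad P(x,t)=c_n\frac{t}{(|x|^2+t^2)^{(n+1)/2}},\qquad c_n=\frac{\Gamma(\frac{n+1}{2})}{\pi^{(n+1)/2}}.$$ Let $\mathcal{M}f(x,t)=\sup_{x\in Q,\,l(Q)\ge t}\frac1{|Q|}\int_Q|f|$, let $M f(x)=\sup_{x\in Q}\frac1{|Q|}\int_Q|f|$ be the Hardy--Littlewood maximal function, and for $\Psi:[0,\infty)\to[0,\infty]$ let $\|f\|_{\Psi,Q}=\inf\{\lambda>0:\frac1{|Q|}\int_Q\Psi(|f|/\lambda)\,dx\le1\}$ and $M_\Psi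 f(x)=\sup_{x\in Q}\|f\|_{\Psi,Q}$. A Young function is a continuous, strictly increasing, convex $\Phi:[0,\infty)\to[0,\infty)$ with $\Phi(0)=0$ and $\lim_{t\to\infty}\Phi(t)=\infty$. A complementary function of $\Phi$ is a nondecreasing convex $\bar\Phi:[0,\infty)\to[0,\infty]$ with $\bar\Phi(0)=0$ and $t\le\Phi^{-1}(t)\,\bar\Phi^{-1}(t)\le 2t$ for all $t\ge 0$, where $\bar\Phi^{-1}(t)=\sup\{s:\bar\Phi(s)\le t\}$ (for example the Legendre conjugate of $\Phi$). For a positive Borel measure $\mu$ on $\mathbb{R}^{n+1}_+$ define, with suprema over all cubes, $$[\mu,\sigma]_{A'_p}=\sup_Q\frac{\mu(\tilde Q)}{|Q|}\Big(\frac{\sigma(Q)}{|Q|}\Big)^{p-1},\qquad [\mu,\sigma]_{S'_p}=\sup_Q\Big(\frac{\int_{\tilde Q}\mathcal{M}(\sigma\chi_Q)^p\,d\mu}{\sigma(Q)}\Big)^{1/p},$$ $$[\mu,\sigma,\Phi]_{A'_p}=\sup_Q\frac{\mu(\tilde Q)}{|Q|}\big\|\sigma^{1/p'}\big\|_{\Phi,Q}^p,\qquad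 [\sigma,\bar\Phi]_{W_p}=\sup_Q\frac{1}{\sigma(Q)}\int_Q M_{\bar\Phi}(\sigma^{1/p}\chi_Q)^p\,dx,$$ $$\lceil\mu,\sigma\rceil_{p,\varepsilon}=\sup_Q\rho(Q)\,\varepsilon(\rho(Q))\Big(\frac{\sigma(Q)}{|Q|}\Big)^{p-1}\frac{\mu(\tilde Q)}{|Q|},\qquad \rho(Q)=\frac{1}{\sigma(Q)}\int_Q M(\sigma\chi_Q)\,dx,$$ where $\varepsilon$ is a monotonic increasing function with $\int_{1/2}^\infty\frac{1}{\varepsilon(t)}\frac{dt}{t}=1$. All these quantities take values in $[0,\infty]$, with $0\cdot\infty=0/0=0$ and $\infty\cdot\varepsilon(\infty)=\infty$. **Corollary.** There is a constant $C$ depending only on $n$ and $p$ such that, for every positive Borel measure $\mu$ on $\mathbb{R}^{n+1}_+$, every weight $\sigma$, every Young function $\Phi$ with complementary function $\bar\Phi$, and every $\varepsilon$ as above, the operator $f\mapsto P(f\sigma)$ satisfies 1. $\|P(\cdot\,\sigma)\|_{L^p(\mathbb{R}^n,\sigma)\to L^{p,\infty}(\mathbb{R}^{n+1}_+,\mu)}\le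 C\,[\mu,\sigma]_{A'_p}^{1/p}$; 2. $\|P(\cdot\,\sigma)\|_{L^p(\mathbb{R}^n,\sigma)\to L^p(\mathbb{R}^{n+1}_+,\mu)}\le C\,[\mu,\sigma]_{S'_p}$; 3. $\|P(\cdot\,\sigma)\|_{L^p(\mathbb{R}^n,\sigma)\to L^p(\mathbb{R}^{n+1}_+,\mu)}\le C\,\big([\mu,\sigma,\Phi]_{A'_p}[\sigma,\bar\Phi]_{W_p}\big)^{1/p}$; 4. $\|P(\cdot\,\sigma)\|_{L^p(\mathbb{R}^n,\sigma)\to L^p(\mathbb{R}^{n+1}_+,\mu)}\le C\,\lceil\mu,\sigma\rceil_{p,\varepsilon}^{1/p}$. In particular, whenever the right-hand side is finite, the integral defining $P(f\sigma)(x,t)$ converges absolutely for $\mu$-almost every $(x,t)$, for every $f\in L^p(\sigma)$. -/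

import Mathlib

open MeasureTheory Set
open scoped ENNReal NNReal

noncomputable section

namespace PoissonCarleson

/-- The Euclidean space `ℝⁿ`. -/
abbrev Space (n : ℕ) : Type := EuclideanSpace ℝ (Fin n)

/-- The closed half-space `{(x, t) : x ∈ ℝⁿ, t ≥ 0}`, with its product (Borel) sigma-algebra. -/
abbrev HalfSpace (n : ℕ) : Type := EuclideanSpace ℝ (Fin n) × ℝ≥0

/-! ### Cubes and maximal functions -/

/-- A cube of `ℝⁿ` with sides parallel to the axes, given by its lower corner and side length. -/
structure Cube (n : ℕ) where
  corner : Space n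
  side : ℝ≥0
  side_pos : 0 < side

variable {n : ℕ}

/-- The points of the (closed) cube. -/
def Cube.toSet (Q : Cube n) : Set (Space n) :=
  {x | ∀ i, Q.corner i ≤ x i ∧ x i ≤ Q.corner i + Q.side}

/-- The cube `{(x, t) : x ∈ Q, 0 ≤ t < l(Q)}` of the half-space having `Q` as a face. -/
def Cube.tilde (Q : Cube n) : Set (HalfSpace n) :=
  {z | z.1 ∈ Q.toSet ∧ z.2 < Q.side}

/-- The average `|Q|⁻¹ ∫_Q g` of a nonnegative function. -/
def Cube.average (Q : Cube n) (g : Space n → ℝ≥0∞) : ℝ≥0∞ :=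
  (volume Q.toSet)⁻¹ * ∫⁻ y in Q.toSet, g y

/-- The mass `σ(Q) = ∫_Q σ`. -/
def Cube.mass (Q : Cube n) (σ : Space n → ℝ≥0) : ℝ≥0∞ :=
  ∫⁻ y in Q.toSet, (σ y : ℝ≥0∞)

/-- The function `σ χ_Q`, with values in `[0, ∞]`. -/
def Cube.restrict (Q : Cube n) (σ : Space n → ℝ≥0) : Space n → ℝ≥0∞ :=
  Q.toSet.indicator fun y => (σ y : ℝ≥0∞)

/-- Carleson's maximal operator on the half-space, for a nonnegative function `g`:
the supremum of the averages of `g` over the cubes `Q ∋ x` with `l(Q) ≥ t`. -/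
def carlesonMaximal (g : Space n → ℝ≥0∞) (z : HalfSpace n) : ℝ≥0∞ :=
  ⨆ (Q : Cube n) (_ : z.1 ∈ Q.toSet) (_ : z.2 ≤ Q.side), Q.average g

/-- The Hardy-Littlewood maximal function of a nonnegative function `g`. -/
def hardyLittlewood (g : Space n → ℝ≥0∞) (x : Space n) : ℝ≥0∞ :=
  ⨆ (Q : Cube n) (_ : x ∈ Q.toSet), Q.average g

/-! ### Weights, Young functions and Orlicz averages -/

/-- A weight: a nonnegative locally integrable function on `ℝⁿ`. -/
def IsWeight (σ : Space n → ℝ≥0) : Prop :=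
  LocallyIntegrable (fun x => (σ x : ℝ)) volume

/-- The measure `σ dx`. -/
def weightMeasure (σ : Space n → ℝ≥0) : Measure (Space n) :=
  volume.withDensity fun x => (σ x : ℝ≥0∞)

/-- Young functions on `[0, ∞)`. -/
structure IsYoung (Φ : ℝ≥0 → ℝ≥0) : Prop where
  continuous : Continuous Φ
  strictMono : StrictMono Φ
  convex : ConvexOn ℝ≥0 univ Φ
  map_zero : Φ 0 = 0
  tendsto : Filter.Tendsto Φ Filter.atTop Filter.atTop

/-- The (generalized) inverse `t ↦ sup {s ≥ 0 : Ψ(s) ≤ t}`; it is the ordinary inverse function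
when `Ψ` is a finite Young function. -/
def youngInv (Ψ : ℝ≥0 → ℝ≥0∞) (t : ℝ≥0) : ℝ≥0∞ :=
  ⨆ (s : ℝ≥0) (_ : Ψ s ≤ t), (s : ℝ≥0∞)

/-- `Ψ` is a complementary function of the Young function `Φ`: it is convex and increasing with
`Ψ(0) = 0`, and `t ≤ Φ⁻¹(t) Ψ⁻¹(t) ≤ 2 t` for all `t`. The value `∞` is allowed for `Ψ`, so that
the Legendre conjugate `s ↦ sup_t (s t - Φ(t))` is a complementary function of every `Φ`,
also when `Φ` grows only linearly. -/
structure IsComplementary (Φ : ℝ≥0 → ℝ≥0) (Ψ : ℝ≥0 → ℝ≥0∞) : Prop where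
  mono : Monotone Ψ
  convex : ConvexOn ℝ≥0 univ Ψ
  map_zero : Ψ 0 = 0
  le_mul : ∀ t : ℝ≥0, (t : ℝ≥0∞) ≤ youngInv (fun s => (Φ s : ℝ≥0∞)) t * youngInv Ψ t
  mul_le : ∀ t : ℝ≥0, youngInv (fun s => (Φ s : ℝ≥0∞)) t * youngInv Ψ t ≤ 2 * (t : ℝ≥0∞)

/-- The localized Luxemburg norm `‖f‖_{Ψ,Q}` of a nonnegative function
(infinite when no `λ` is admissible). -/
def luxemburg (Ψ : ℝ≥0 → ℝ≥0∞) (f : Space n → ℝ≥0) (Q : Cube n) : ℝ≥0∞ :=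
  ⨅ (r : ℝ≥0) (_ : 0 < r) (_ : Q.average (fun y => Ψ (f y / r)) ≤ 1), (r : ℝ≥0∞)

/-- The Orlicz maximal function `M_Ψ f(x) = sup_{Q ∋ x} ‖f‖_{Ψ,Q}`. -/
def orliczMaximal (Ψ : ℝ≥0 → ℝ≥0∞) (f : Space n → ℝ≥0) (x : Space n) : ℝ≥0∞ :=
  ⨆ (Q : Cube n) (_ : x ∈ Q.toSet), luxemburg Ψ f Q

/-! ### The constants -/

/-- `[μ, σ]_{A'_p}`. -/
def apConst (p : ℝ) (μ : Measure (HalfSpace n)) (σ : Space n → ℝ≥0) : ℝ≥0∞ :=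
  ⨆ Q : Cube n, μ Q.tilde / volume Q.toSet * (Q.mass σ / volume Q.toSet) ^ (p - 1)

/-- `[μ, σ]_{S'_p}`. -/
def spConst (p : ℝ) (μ : Measure (HalfSpace n)) (σ : Space n → ℝ≥0) : ℝ≥0∞ :=
  ⨆ Q : Cube n,
    ((∫⁻ z in Q.tilde, carlesonMaximal (Q.restrict σ) z ^ p ∂μ) / Q.mass σ) ^ (1 / p)

/-- `[μ, σ, Φ]_{A'_p}`. -/
def bumpConst (p : ℝ) (μ : Measure (HalfSpace n)) (σ : Space n → ℝ≥0) (Φ : ℝ≥0 → ℝ≥0∞) : ℝ≥0∞ :=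
  ⨆ Q : Cube n,
    μ Q.tilde / volume Q.toSet * luxemburg Φ (fun x => σ x ^ (1 / p.conjExponent)) Q ^ p

/-- `[σ, Ψ]_{W_p}`. -/
def wpConst (p : ℝ) (σ : Space n → ℝ≥0) (Ψ : ℝ≥0 → ℝ≥0∞) : ℝ≥0∞ :=
  ⨆ Q : Cube n,
    (∫⁻ x in Q.toSet, orliczMaximal Ψ (Q.toSet.indicator fun y => σ y ^ (1 / p)) x ^ p) / Q.mass σ

/-- Admissible entropy functions: `ε` is increasing on `[1/2, ∞)` and
`∫_{1/2}^∞ dt / (ε(t) t) = 1`. The integral is taken in `[0, ∞]` with `1/0 = ∞` and negative values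
truncated to `0`, so that it forces `ε > 0` on `(1/2, ∞)`. -/
structure IsEntropyFunction (ε : ℝ → ℝ) : Prop where
  mono : MonotoneOn ε (Ici (1 / 2))
  integral_eq : ∫⁻ t in Ioi (1 / 2 : ℝ), (ENNReal.ofReal (ε t * t))⁻¹ = 1

/-- `ρ(Q) = σ(Q)⁻¹ ∫_Q M(σ χ_Q)`. -/
def Cube.rho (Q : Cube n) (σ : Space n → ℝ≥0) : ℝ≥0∞ :=
  (∫⁻ x in Q.toSet, hardyLittlewood (Q.restrict σ) x) / Q.mass σ

open Classical in
/-- `ρ_{σ,ε}(Q) = ρ(Q) ε(ρ(Q))`, which is infinite when `ρ(Q)` is. -/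
def Cube.rhoEps (Q : Cube n) (σ : Space n → ℝ≥0) (ε : ℝ → ℝ) : ℝ≥0∞ :=
  if Q.rho σ = ∞ then ∞ else Q.rho σ * ENNReal.ofReal (ε (Q.rho σ).toReal)

/-- `⌈μ, σ⌉_{p,ε}`. -/
def entropyConst (p : ℝ) (μ : Measure (HalfSpace n)) (σ : Space n → ℝ≥0) (ε : ℝ → ℝ) : ℝ≥0∞ :=
  ⨆ Q : Cube n, Q.rhoEps σ ε * (Q.mass σ / volume Q.toSet) ^ (p - 1)
    * (μ Q.tilde / volume Q.toSet)

/-! ### The Poisson integral and its operator norms -/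

/-- The Poisson kernel `c_n t / (|x|² + t²)^((n+1)/2)`, with the normalizing constant
`c_n = Γ((n+1)/2) / π^((n+1)/2)`. -/
def poissonKernel (x : Space n) (t : ℝ≥0) : ℝ :=
  Real.Gamma (((n : ℝ) + 1) / 2) / Real.pi ^ (((n : ℝ) + 1) / 2)
    * ((t : ℝ) / (‖x‖ ^ 2 + (t : ℝ) ^ 2) ^ (((n : ℝ) + 1) / 2))

/-- The Poisson integral `P g(x,t) = ∫ g(y) P(x - y, t) dy`. -/
def poissonIntegral (g : Space n → ℂ) (z : HalfSpace n) : ℂ :=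
  ∫ y, poissonKernel (z.1 - y) z.2 • g y

/-- The integral that defines `P g` at the point `z` converges absolutely. -/
def PoissonDefinedAt (g : Space n → ℂ) (z : HalfSpace n) : Prop :=
  Integrable (fun y => poissonKernel (z.1 - y) z.2 • g y) volume

/-- The weak `L^p` quasi-norm `sup_α α μ{|F| > α}^(1/p)`. -/
def weakLpNorm (p : ℝ) (μ : Measure (HalfSpace n)) (F : HalfSpace n → ℂ) : ℝ≥0∞ :=
  ⨆ a : ℝ≥0, (a : ℝ≥0∞) * μ {z | (a : ℝ≥0∞) < ‖F z‖ₑ} ^ (1 / p)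

/-- The strong `L^p` norm. -/
def strongLpNorm (p : ℝ) (μ : Measure (HalfSpace n)) (F : HalfSpace n → ℂ) : ℝ≥0∞ :=
  eLpNorm F (ENNReal.ofReal p) μ

/-- The norm of the operator `f ↦ P(f σ)` from `L^p(σ)` into the functions on the half-space with
the quasi-norm `N`: the least `K` such that, for all `f ∈ L^p(σ)`, the function `P(f σ)` is defined
`μ`-almost everywhere, is `μ`-measurable and satisfies `N(P(f σ)) ≤ K ‖f‖_{L^p(σ)}`. It is infinite
if there is no such `K`. -/
def poissonOpNorm (p : ℝ) (μ : Measure (HalfSpace n)) (σ : Space n → ℝ≥0)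
    (N : (HalfSpace n → ℂ) → ℝ≥0∞) : ℝ≥0∞ :=
  sInf {K : ℝ≥0∞ | ∀ f : Space n → ℂ, MemLp f (ENNReal.ofReal p) (weightMeasure σ) →
    (∀ᵐ z ∂μ, PoissonDefinedAt (fun y => σ y • f y) z) ∧
    AEStronglyMeasurable (poissonIntegral fun y => σ y • f y) μ ∧
    N (poissonIntegral fun y => σ y • f y) ≤
      K * eLpNorm f (ENNReal.ofReal p) (weightMeasure σ)}

end PoissonCarleson

end

open PoissonCarleson

/-! The Poisson kernel is positive and, on dyadic annuli, is a sum of averages over balls of radius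
`2 ^ j * t` with weights `2⁻¹ ^ j`. Each such ball lies in a comparable cube of one of the `2 ^ n`
shifted dyadic grids, and the tent over that cube contains `(x, t)`. Hence `|P(fσ)|` is at most a
constant times the sum over the grids of the dyadic maximal functions of the measure `|f|σ` on the
half-space (`exists_lintegral_poisson_le_gridMax`). It remains to bound one such maximal function,
and by monotone convergence one over a finite family of cubes.

Weak type: the level set at height `a` is a union of tents over cubes with average above `a`.
Hölder's inequality and the `A'_p` constant bound `a ^ p` times the measure of each tent by `∫_Q
|f|^p σ`, and the maximal cubes are disjoint.

Strong type: choose principal cubes for the Lebesgue averages of `|f|σ`. They are sparse, and up to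
a factor two the maximal function is controlled by them (`lintegral_finiteMax_le`). An average of
`|f|σ` is the `σ`-average of `|f|` times the density `σ(Q)/|Q|`, so everything reduces to sums of
`σ`-averages to the power `p` with coefficients `tentCoeff`. `carleson_embedding` bounds such a sum
as soon as the coefficients of the cubes inside a cube `R` add up to at most `A σ(R)`. The testing
constant gives this through the disjointness of the residual tents (`sum_tentCoeff_le_testing`). The
bump constant gives it through the generalized Hölder inequality and sparseness
(`sum_tentCoeff_le_bump`). For the entropy constant, the cubes are split by the dyadic size of
`ρ(Q)`: each level is a Carleson family with constant about `2 ^ k`, and the series of `1 / ε(2 ^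
k)` sums the levels (`sum_average_mul_tentCoeff_le_entropy`). -/

namespace PoissonCarleson

/-! ### Finite laminar families -/

section Laminar

variable {ι X Y : Type*}

/-- A family of sets any two of which are either disjoint or strictly nested. -/
def IsLaminar (D : ι → Set X) : Prop :=
  ∀ i j, i ≠ j → Disjoint (D i) (D j) ∨ D i ⊂ D j ∨ D j ⊂ D i

/-- Selection of principal members of a finite family of sets. -/
theorem exists_principal (D : ι → Set X) (a : ι → ℝ≥0∞) (F : Finset ι) :
    ∃ S ⊆ F, (∀ i ∈ F, ∃ j ∈ S, D i ⊆ D j ∧ a i ≤ 2 * a j) ∧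
      ∀ i ∈ S, ∀ j ∈ S, D i ⊂ D j → 2 * a j < a i := by
  classical
  induction F using Finset.strongInduction with
  | H F ih =>
    rcases F.eq_empty_or_nonempty with rfl | hF
    · exact ⟨∅, by simp⟩
    -- Members are decided upon with the large sets first: a minimal one comes last, so adding it
    -- cannot spoil the separation of those already chosen.
    obtain ⟨q, hqF, hq⟩ := F.exists_minimalFor D hF
    obtain ⟨S, hSF, h1, h2⟩ := ih (F.erase q) (Finset.erase_ssubset hqF)
    have hSF' : S ⊆ F := hSF.trans (F.erase_subset q)
    by_cases hc : ∃ j ∈ S, D q ⊆ D j ∧ a q ≤ 2 * a j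
    · refine ⟨S, hSF', fun i hi => ?_, h2⟩
      by_cases hiq : i = q
      · subst hiq; exact hc
      · exact h1 i (Finset.mem_erase.2 ⟨hiq, hi⟩)
    · push Not at hc
      refine ⟨insert q S, Finset.insert_subset hqF hSF', fun i hi => ?_, ?_⟩
      · by_cases hiq : i = q
        · subst hiq
          refine ⟨i, Finset.mem_insert_self _ _, Subset.rfl, ?_⟩
          rw [two_mul]; exact le_self_add
        · obtain ⟨j, hj, h⟩ := h1 i (Finset.mem_erase.2 ⟨hiq, hi⟩)
          exact ⟨j, Finset.mem_insert_of_mem hj, h⟩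
      · intro i hi j hj hij
        rcases Finset.mem_insert.1 hi with hi' | hi'
        · rcases Finset.mem_insert.1 hj with hj' | hj'
          · exact absurd hij (by rw [hi', hj']; exact ssubset_irrefl _)
          · subst hi'; exact hc j hj' hij.subset
        · rcases Finset.mem_insert.1 hj with hj' | hj'
          · subst hj'; exact absurd (hq (hSF' hi') hij.subset) hij.2
          · exact h2 i hi' j hj' hij

/-- The maximal members of a finite laminar family are disjoint and have the same union. -/
theorem exists_disjoint_cover {D : ι → Set X} (hD : IsLaminar D) (F : Finset ι) :
    ∃ G ⊆ F, (∀ i ∈ F, ∃ j ∈ G, D i ⊆ D j) ∧ (G : Set ι).PairwiseDisjoint D := by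
  classical
  refine ⟨F.filter fun i => ∀ j ∈ F, ¬ D i ⊂ D j, Finset.filter_subset _ _, fun i hi => ?_, ?_⟩
  · obtain ⟨j, hj, hmax⟩ := (F.filter fun j => D i ⊆ D j).exists_maximalFor D
      ⟨i, by simp [hi]⟩
    rw [Finset.mem_filter] at hj
    refine ⟨j, Finset.mem_filter.2 ⟨hj.1, fun k hk hjk => ?_⟩, hj.2⟩
    exact hjk.2 (hmax (Finset.mem_filter.2 ⟨hk, hj.2.trans hjk.subset⟩) hjk.subset)
  · intro i hi j hj hij
    simp only [Finset.coe_filter, mem_ofPred_eq] at hi hj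
    rcases hD i j hij with h | h | h
    · exact h
    · exact absurd h (hi.2 j hj.1)
    · exact absurd h (hj.2 i hi.1)

/-- A measure that is dominated by another one on the members of a laminar family is dominated on
the union, even if the first one is taken on sets `E i` that lie over the members. -/
theorem measure_biUnion_le_of_isLaminar [MeasurableSpace X] [MeasurableSpace Y]
    {D : ι → Set X} (hD : IsLaminar D) (hDm : ∀ i, MeasurableSet (D i)) {E : ι → Set Y}
    (hE : ∀ i j, D i ⊆ D j → E i ⊆ E j) (μ : Measure Y) (ν : Measure X) (F : Finset ι)
    (h : ∀ i ∈ F, μ (E i) ≤ ν (D i)) :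
    μ (⋃ i ∈ F, E i) ≤ ν (⋃ i ∈ F, D i) := by
  obtain ⟨G, hGF, hcov, hdisj⟩ := exists_disjoint_cover hD F
  calc μ (⋃ i ∈ F, E i) ≤ μ (⋃ i ∈ G, E i) := by
        refine measure_mono (iUnion₂_subset fun i hi => ?_)
        obtain ⟨j, hj, hij⟩ := hcov i hi
        exact (hE i j hij).trans (subset_biUnion_of_mem (u := E) hj)
    _ ≤ ∑ i ∈ G, μ (E i) := measure_biUnion_finset_le _ _
    _ ≤ ∑ i ∈ G, ν (D i) := Finset.sum_le_sum fun i hi => h i (hGF hi)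
    _ = ν (⋃ i ∈ G, D i) := (measure_biUnion_finset hdisj fun i _ => hDm i).symm
    _ ≤ ν (⋃ i ∈ F, D i) := measure_mono (biUnion_subset_biUnion_left hGF)

open Classical in
/-- What remains of `E i` when the `E j` over the smaller members `D j` of the family are removed. -/
def residual (D : ι → Set X) (E : ι → Set Y) (S : Finset ι) (i : ι) : Set Y :=
  E i \ ⋃ j ∈ S.filter fun j => D j ⊂ D i, E j

theorem residual_subset (D : ι → Set X) (E : ι → Set Y) (S : Finset ι) (i : ι) :
    residual D E S i ⊆ E i := sdiff_subset

theorem measurableSet_residual [MeasurableSpace Y] (D : ι → Set X) {E : ι → Set Y}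
    (hE : ∀ i, MeasurableSet (E i)) (S : Finset ι) (i : ι) : MeasurableSet (residual D E S i) :=
  (hE i).diff (Finset.measurableSet_biUnion _ fun j _ => hE j)

/-- If two members are nested, the whole `E` of the smaller is cut out of the residual of the
larger. If they are disjoint, so are the sets `E`. -/
theorem pairwiseDisjoint_residual {D : ι → Set X} (hD : IsLaminar D) {E : ι → Set Y}
    (hE : ∀ i j, Disjoint (D i) (D j) → Disjoint (E i) (E j)) (S : Finset ι) :
    (S : Set ι).PairwiseDisjoint (residual D E S) := by
  classical
  have key : ∀ i ∈ S, ∀ j, D i ⊂ D j → Disjoint (residual D E S i) (residual D E S j) := by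
    intro i hi j hij
    refine Set.disjoint_left.2 fun y hy hy' => hy'.2 ?_
    exact mem_biUnion (Finset.mem_coe.2 (Finset.mem_filter.2 ⟨hi, hij⟩)) hy.1
  intro i hi j hj hij
  rcases hD i j hij with h | h | h
  · exact (hE i j h).mono sdiff_subset sdiff_subset
  · exact key i hi j h
  · exact (key j hj i h).symm

/-- Among the members whose `E` contains `y`, a minimal one has lost nothing at `y`; laminarity
places it inside `D i`. -/
theorem exists_mem_residual {D : ι → Set X} (hD : IsLaminar D) {E : ι → Set Y}
    (hE : ∀ i j, Disjoint (D i) (D j) → Disjoint (E i) (E j)) {S : Finset ι} {i : ι} (hi : i ∈ S)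
    {y : Y} (hy : y ∈ E i) : ∃ j ∈ S, D j ⊆ D i ∧ y ∈ residual D E S j := by
  classical
  obtain ⟨j, hj, hmin⟩ := (S.filter fun j => y ∈ E j).exists_minimalFor D
    ⟨i, Finset.mem_filter.2 ⟨hi, hy⟩⟩
  rw [Finset.mem_filter] at hj
  refine ⟨j, hj.1, ?_, hj.2, ?_⟩
  · by_cases hij : i = j
    · rw [hij]
    rcases hD i j hij with h | h | h
    · exact absurd hj.2 (Set.disjoint_left.1 (hE i j h) hy)
    · exact hmin (Finset.mem_filter.2 ⟨hi, hy⟩) h.subset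
    · exact h.subset
  · simp only [Finset.mem_filter, mem_iUnion, not_exists]
    intro k hk hyk
    exact hk.2.2 (hmin (Finset.mem_filter.2 ⟨hk.1, hyk⟩) hk.2.subset)

/-- A sum over the disjoint residual sets is dominated by the integral of a function that exceeds
`c i` on `E i`. -/
theorem sum_mul_measure_residual_le_lintegral [MeasurableSpace Y] {D : ι → Set X}
    (hD : IsLaminar D) {E : ι → Set Y} (hE : ∀ i j, Disjoint (D i) (D j) → Disjoint (E i) (E j))
    (hEm : ∀ i, MeasurableSet (E i)) {μ : Measure Y} {S G : Finset ι} (hG : G ⊆ S)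
    {c : ι → ℝ≥0∞} {A : Set Y} (hA : ∀ i ∈ G, E i ⊆ A) {h : Y → ℝ≥0∞}
    (hc : ∀ i ∈ G, ∀ y ∈ E i, c i ≤ h y) :
    ∑ i ∈ G, c i * μ (residual D E S i) ≤ ∫⁻ y in A, h y ∂μ := by
  have hm := measurableSet_residual D hEm S
  calc ∑ i ∈ G, c i * μ (residual D E S i) = ∑ i ∈ G, ∫⁻ _ in residual D E S i, c i ∂μ :=
        Finset.sum_congr rfl fun i _ => by rw [setLIntegral_const]
    _ ≤ ∑ i ∈ G, ∫⁻ y in residual D E S i, h y ∂μ :=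
        Finset.sum_le_sum fun i hi => setLIntegral_mono' (hm i) fun y hy => hc i hi y hy.1
    _ = ∫⁻ y in ⋃ i ∈ G, residual D E S i, h y ∂μ := by
        rw [lintegral_biUnion_finset
          ((pairwiseDisjoint_residual hD hE S).subset (by exact_mod_cast hG)) fun i _ => hm i]
    _ ≤ ∫⁻ y in A, h y ∂μ :=
        lintegral_mono_set (iUnion₂_subset fun i hi => (residual_subset D E S i).trans (hA i hi))

/-- Principal families are sparse. -/
theorem measure_le_two_mul_residual [MeasurableSpace X] {D : ι → Set X} (hD : IsLaminar D)
    (hDm : ∀ i, MeasurableSet (D i)) {ν κ : Measure X} {S : Finset ι} {a : ι → ℝ≥0∞}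
    (ha : ∀ i ∈ S, a i * ν (D i) = κ (D i)) (ha0 : ∀ i ∈ S, a i ≠ 0) (hat : ∀ i ∈ S, a i ≠ ∞)
    (hν : ∀ i ∈ S, ν (D i) ≠ ∞)
    (hS : ∀ i ∈ S, ∀ j ∈ S, D i ⊂ D j → 2 * a j < a i) (i : ι) (hi : i ∈ S) :
    ν (D i) ≤ 2 * ν (residual D D S i) := by
  classical
  set U : Set X := ⋃ j ∈ S.filter fun j => D j ⊂ D i, D j with hU
  have hUm : MeasurableSet U := Finset.measurableSet_biUnion _ fun j _ => hDm j
  have hUi : U ⊆ D i := iUnion₂_subset fun j hj => (Finset.mem_filter.1 hj).2.subset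
  -- The smaller principal members have `κ`-density above `2 * a i`, yet together carry at most the
  -- `κ`-mass of `D i`; so they fill at most half of its `ν`-mass.
  have h1 : (2 * a i) * ν U ≤ a i * ν (D i) := by
    rw [ha i hi]
    refine le_trans ?_ (measure_mono hUi)
    refine measure_biUnion_le_of_isLaminar hD hDm (E := D) (fun _ _ h => h) ((2 * a i) • ν) κ _ ?_
    intro j hj
    rw [Finset.mem_filter] at hj
    rw [Measure.smul_apply, smul_eq_mul, ← ha j hj.1]
    gcongr
    exact (hS j hj.1 i hi hj.2).le
  have h2 : 2 * ν U ≤ ν (D i) := by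
    rw [mul_comm 2, mul_assoc] at h1
    exact (ENNReal.mul_le_mul_iff_right (ha0 i hi) (hat i hi)).1 h1
  have h3 : ν (residual D D S i) + ν U = ν (D i) := by
    have := measure_sdiff_add_inter (μ := ν) (D i) hUm
    rwa [inter_eq_right.2 hUi] at this
  have hUt : ν U ≠ ∞ := measure_ne_top_of_subset hUi (hν i hi)
  have h4 : ν (D i) + ν (D i) ≤ 2 * ν (residual D D S i) + ν (D i) := by
    calc ν (D i) + ν (D i) = 2 * ν (residual D D S i) + 2 * ν U := by rw [← h3]; ring
      _ ≤ _ := by gcongr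
  exact (ENNReal.add_le_add_iff_right (hν i hi)).1 h4

end Laminar

/-! ### Carleson's embedding theorem -/

section Embedding

/-- The sum of the geometric series with ratio `2⁻ˢ`. -/
noncomputable def geomConst (s : ℝ) : ℝ≥0∞ := (1 - (2⁻¹ : ℝ≥0∞) ^ s)⁻¹

theorem inv_two_rpow_lt_one {s : ℝ} (hs : 0 < s) : (2⁻¹ : ℝ≥0∞) ^ s < 1 :=
  ENNReal.rpow_lt_one (by simp) hs

theorem geomConst_ne_top {s : ℝ} (hs : 0 < s) : geomConst s ≠ ∞ :=
  ENNReal.inv_ne_top.2 (tsub_pos_of_lt (inv_two_rpow_lt_one hs)).ne'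

/-- The fixed-point equation of the geometric series; it closes the induction in
`sum_rpow_le_of_separated`. -/
theorem one_add_geomConst_mul {s : ℝ} (hs : 0 < s) :
    1 + geomConst s * (2⁻¹ : ℝ≥0∞) ^ s = geomConst s := by
  set r := (2⁻¹ : ℝ≥0∞) ^ s with hr
  have hr1 : r < 1 := inv_two_rpow_lt_one hs
  have h0 : (1 - r) ≠ 0 := (tsub_pos_of_lt hr1).ne'
  have ht : (1 - r) ≠ ∞ := ENNReal.sub_ne_top ENNReal.one_ne_top
  have h : geomConst s * (1 - r) = 1 := ENNReal.inv_mul_cancel h0 ht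
  calc 1 + geomConst s * r = geomConst s * ((1 - r) + r) := by rw [mul_add, h]
    _ = geomConst s := by rw [tsub_add_cancel_of_le hr1.le, mul_one]

/-- A finite sum of powers of numbers that are separated by factors two. -/
theorem sum_rpow_le_of_separated {ι : Type*} {s : ℝ} (hs : 0 < s) (a : ι → ℝ≥0∞) (U : Finset ι)
    (hU : ∀ i ∈ U, ∀ j ∈ U, i ≠ j → 2 * a i < a j ∨ 2 * a j < a i) (M : ℝ≥0∞)
    (hM : ∀ i ∈ U, a i ≤ M) : ∑ i ∈ U, a i ^ s ≤ geomConst s * M ^ s := by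
  classical
  -- Once the largest term is removed, separation puts all others below `M / 2`, so the bound `M`
  -- halves at each step.
  induction U using Finset.induction_on_max_value a generalizing M with
  | empty => simp
  | insert m U hmU hmax ih =>
    rw [Finset.sum_insert hmU]
    have h1 : ∀ i ∈ U, a i ≤ 2⁻¹ * M := by
      intro i hi
      have h2 : 2 * a i < a m := by
        rcases hU i (Finset.mem_insert_of_mem hi) m (Finset.mem_insert_self _ _)
          (fun h => hmU (h ▸ hi)) with h | h
        · exact h
        · have := hmax i hi
          have h3 : a m ≤ 2 * a m := by rw [two_mul]; exact le_self_add
          exact absurd (h.trans_le (this.trans h3)) (lt_irrefl _)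
      have h3 := h2.le.trans (hM m (Finset.mem_insert_self _ _))
      calc a i = 2⁻¹ * (2 * a i) := by
            rw [← mul_assoc, ENNReal.inv_mul_cancel (by simp) (by simp), one_mul]
        _ ≤ 2⁻¹ * M := by gcongr
    have h4 := ih (fun i hi j hj => hU i (Finset.mem_insert_of_mem hi) j
      (Finset.mem_insert_of_mem hj)) _ h1
    calc a m ^ s + ∑ i ∈ U, a i ^ s ≤ M ^ s + geomConst s * (2⁻¹ * M) ^ s := by
          gcongr
          exact hM m (Finset.mem_insert_self _ _)
      _ = (1 + geomConst s * (2⁻¹ : ℝ≥0∞) ^ s) * M ^ s := by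
          rw [ENNReal.mul_rpow_of_nonneg _ _ hs.le]; ring
      _ = _ := by rw [one_add_geomConst_mul hs]

/-- Hölder's inequality against the constant function one. -/
theorem lintegral_rpow_le_measure_mul {X : Type*} [MeasurableSpace X] {ν : Measure X} {p : ℝ}
    (hp : 1 < p) {f : X → ℝ≥0∞} (hf : AEMeasurable f ν) (A : Set X) :
    (∫⁻ x in A, f x ∂ν) ^ p ≤ ν A ^ (p - 1) * ∫⁻ x in A, f x ^ p ∂ν := by
  have hpq := Real.HolderConjugate.conjExponent hp
  have hp0 : 0 < p := by linarith
  have h := ENNReal.lintegral_mul_le_Lp_mul_Lq (ν.restrict A) hpq hf.restrict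
    (aemeasurable_const (b := (1 : ℝ≥0∞)))
  simp only [Pi.mul_apply, mul_one, ENNReal.one_rpow, lintegral_const, one_mul,
    Measure.restrict_apply_univ] at h
  calc (∫⁻ x in A, f x ∂ν) ^ p
      ≤ ((∫⁻ x in A, f x ^ p ∂ν) ^ (1 / p) * ν A ^ (1 / p.conjExponent)) ^ p := by gcongr
    _ = ν A ^ (p - 1) * ∫⁻ x in A, f x ^ p ∂ν := by
      rw [ENNReal.mul_rpow_of_nonneg _ _ hp0.le, ← ENNReal.rpow_mul, ← ENNReal.rpow_mul, mul_comm]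
      congr 2
      · rw [Real.conjExponent]
        have : p - 1 ≠ 0 := by linarith
        field_simp
      · rw [one_div_mul_cancel hp0.ne', ENNReal.rpow_one]

variable {ι X : Type*} [MeasurableSpace X] {D : ι → Set X} {ν : Measure X} {f : X → ℝ≥0∞} {p : ℝ}

theorem setLIntegral_ne_top_of_rpow (hp : 1 < p) (hf : AEMeasurable f ν)
    (hfp : ∫⁻ x, f x ^ p ∂ν ≠ ∞) {A : Set X} (hA : ν A ≠ ∞) : ∫⁻ x in A, f x ∂ν ≠ ∞ := by
  have h := lintegral_rpow_le_measure_mul hp hf A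
  have h2 : (∫⁻ x in A, f x ∂ν) ^ p ≠ ∞ := by
    refine ne_top_of_le_ne_top (ENNReal.mul_ne_top ?_ ?_) h
    · exact ENNReal.rpow_ne_top_of_nonneg (by linarith) hA
    · exact ne_top_of_le_ne_top hfp (setLIntegral_le_lintegral _ _)
  intro h3
  rw [h3, ENNReal.top_rpow_of_pos (by linarith)] at h2
  exact h2 rfl

/-- The constant of the embedding theorem. -/
noncomputable def embeddingConst (p : ℝ) : ℝ≥0∞ := 2 ^ p * geomConst (p - 1) ^ p

theorem embeddingConst_ne_top (hp : 1 < p) : embeddingConst p ≠ ∞ :=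
  ENNReal.mul_ne_top (ENNReal.rpow_ne_top_of_nonneg (by linarith) (by simp))
    (ENNReal.rpow_ne_top_of_nonneg (by linarith) (geomConst_ne_top (by linarith)))

/-- A duality argument. The left side `I` equals `∫ f g` with `g = ∑ a_i^(p-1) 1_{D_i}`. The members
containing a given point form a chain along which the `a_i` more than double, so `g ^ q` is at most
a constant times `h = ∑ a_i^p 1_{D_i}`, whose integral is again `I`. Hölder's inequality bounds `I`
by a multiple of `‖f‖_p I^(1/q)`, and the power of `I` is divided out. -/
theorem sum_average_rpow_mul_measure_le (hp : 1 < p) (hD : IsLaminar D)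
    (hDm : ∀ i, MeasurableSet (D i)) (hf : AEMeasurable f ν)
    (S : Finset ι) (a : ι → ℝ≥0∞) (hν : ∀ i ∈ S, ν (D i) ≠ ∞) (hat : ∀ i ∈ S, a i ≠ ∞)
    (ha : ∀ i ∈ S, a i * ν (D i) = ∫⁻ x in D i, f x ∂ν)
    (hS : ∀ i ∈ S, ∀ j ∈ S, D i ⊂ D j → 2 * a j < a i) :
    ∑ i ∈ S, a i ^ p * ν (D i) ≤ geomConst (p - 1) ^ p * ∫⁻ x, f x ^ p ∂ν := by
  classical
  have hp0 : 0 < p := by linarith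
  have hpq := Real.HolderConjugate.conjExponent hp
  set q := p.conjExponent with hq
  have hq0 : 0 < q := hpq.symm.pos
  set c := geomConst (p - 1) with hc
  have hct : c ≠ ∞ := geomConst_ne_top (by linarith)
  set I := ∑ i ∈ S, a i ^ p * ν (D i) with hI
  -- This finiteness, available because the family is finite, is what permits the division by `I ^
  -- (1 / q)`.
  have hIt : I ≠ ∞ := ENNReal.sum_ne_top.2 fun i hi => ENNReal.mul_ne_top
    (ENNReal.rpow_ne_top_of_nonneg hp0.le (hat i hi)) (hν i hi)
  set g : X → ℝ≥0∞ := fun x => ∑ i ∈ S, (D i).indicator (fun _ => a i ^ (p - 1)) x with hg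
  set h : X → ℝ≥0∞ := fun x => ∑ i ∈ S, (D i).indicator (fun _ => a i ^ p) x with hh
  have hgm : Measurable g := Finset.measurable_fun_sum _ fun i _ =>
    measurable_const.indicator (hDm i)
  have h1 : I = ∫⁻ x, (f * g) x ∂ν := by
    have : ∀ x, (f * g) x = ∑ i ∈ S, (D i).indicator (fun y => a i ^ (p - 1) * f y) x := by
      intro x
      simp only [Pi.mul_apply, hg, Finset.mul_sum]
      refine Finset.sum_congr rfl fun i _ => ?_
      by_cases hx : x ∈ D i <;> simp [hx, mul_comm]
    simp_rw [this]
    rw [lintegral_finsetSum' _ fun i _ => (hf.const_mul _).indicator (hDm i)]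
    refine Finset.sum_congr rfl fun i hi => ?_
    rw [lintegral_indicator (hDm i), lintegral_const_mul'' _ hf.restrict, ← ha i hi, ← mul_assoc]
    congr 1
    calc a i ^ p = a i ^ ((p - 1) + 1) := by congr 1; ring
      _ = a i ^ (p - 1) * a i := by
        rw [ENNReal.rpow_add_of_nonneg _ _ (by linarith) zero_le_one, ENNReal.rpow_one]
  have h2 : ∀ x, g x ^ q ≤ c ^ q * h x := by
    intro x
    have e1 : g x = ∑ i ∈ S.filter (fun i => x ∈ D i), a i ^ (p - 1) := by
      simp only [hg, Finset.sum_filter, indicator_apply]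
    have e2 : h x = ∑ i ∈ S.filter (fun i => x ∈ D i), a i ^ p := by
      simp only [hh, Finset.sum_filter, indicator_apply]
    have e3 : g x ≤ c * (h x ^ (1 / p)) ^ (p - 1) := by
      rw [e1]
      refine sum_rpow_le_of_separated (by linarith) a _ ?_ _ ?_
      · intro i hi j hj hij
        rw [Finset.mem_filter] at hi hj
        rcases hD i j hij with h | h | h
        · exact absurd hj.2 (Set.disjoint_left.1 h hi.2)
        · exact Or.inr (hS i hi.1 j hj.1 h)
        · exact Or.inl (hS j hj.1 i hi.1 h)
      · intro i hi
        rw [e2, one_div, ENNReal.le_rpow_inv_iff hp0]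
        exact Finset.single_le_sum (f := fun i => a i ^ p) (fun _ _ => zero_le) hi
    calc g x ^ q ≤ (c * (h x ^ (1 / p)) ^ (p - 1)) ^ q := by gcongr
      _ = c ^ q * h x := by
        rw [ENNReal.mul_rpow_of_nonneg _ _ hq0.le, ← ENNReal.rpow_mul, ← ENNReal.rpow_mul]
        have : 1 / p * ((p - 1) * q) = 1 := by
          rw [hq, Real.conjExponent]
          have : p - 1 ≠ 0 := by linarith
          field_simp
        rw [this, ENNReal.rpow_one]
  have h3 : ∫⁻ x, h x ∂ν = I := by
    rw [hh, lintegral_finsetSum _ fun i _ => measurable_const.indicator (hDm i)]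
    exact Finset.sum_congr rfl fun i _ => by rw [lintegral_indicator_const (hDm i)]
  have h4 : (∫⁻ x, g x ^ q ∂ν) ^ (1 / q) ≤ c * I ^ (1 / q) := by
    calc (∫⁻ x, g x ^ q ∂ν) ^ (1 / q) ≤ (∫⁻ x, c ^ q * h x ∂ν) ^ (1 / q) := by
          gcongr with x; exact h2 x
      _ = (c ^ q * I) ^ (1 / q) := by
        rw [lintegral_const_mul' _ _ (ENNReal.rpow_ne_top_of_nonneg hq0.le hct), h3]
      _ = c * I ^ (1 / q) := by
        rw [ENNReal.mul_rpow_of_nonneg _ _ (by positivity), ← ENNReal.rpow_mul,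
          mul_one_div_cancel hq0.ne', ENNReal.rpow_one]
  have h5 : I ≤ (∫⁻ x, f x ^ p ∂ν) ^ (1 / p) * (c * I ^ (1 / q)) := by
    calc I = ∫⁻ x, (f * g) x ∂ν := h1
      _ ≤ _ := ENNReal.lintegral_mul_le_Lp_mul_Lq ν hpq hf hgm.aemeasurable
      _ ≤ _ := by gcongr
  by_cases hI0 : I = 0
  · rw [hI0]; exact zero_le
  have h6 : I ^ (1 / p) ≤ c * (∫⁻ x, f x ^ p ∂ν) ^ (1 / p) := by
    have hIq0 : I ^ (1 / q) ≠ 0 := by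
      simp [ENNReal.rpow_eq_zero_iff, hI0, hIt]
    have hIqt : I ^ (1 / q) ≠ ∞ := ENNReal.rpow_ne_top_of_nonneg (by positivity) hIt
    refine (ENNReal.mul_le_mul_iff_left hIq0 hIqt).1 ?_
    calc I ^ (1 / p) * I ^ (1 / q) = I := by
          rw [← ENNReal.rpow_add _ _ hI0 hIt]
          have := hpq.inv_add_inv_eq_one
          rw [one_div, one_div, this, ENNReal.rpow_one]
      _ ≤ _ := h5
      _ = _ := by ring
  calc I = (I ^ (1 / p)) ^ p := by
        rw [← ENNReal.rpow_mul, one_div_mul_cancel hp0.ne', ENNReal.rpow_one]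
    _ ≤ (c * (∫⁻ x, f x ^ p ∂ν) ^ (1 / p)) ^ p := by gcongr
    _ = _ := by
      rw [ENNReal.mul_rpow_of_nonneg _ _ hp0.le, ← ENNReal.rpow_mul, one_div_mul_cancel hp0.ne',
        ENNReal.rpow_one]

/-- Carleson's embedding theorem for a finite laminar family. -/
theorem carleson_embedding (hp : 1 < p) (hD : IsLaminar D)
    (hDm : ∀ i, MeasurableSet (D i)) (hf : AEMeasurable f ν) (hfp : ∫⁻ x, f x ^ p ∂ν ≠ ∞)
    (S : Finset ι) (hν0 : ∀ i ∈ S, ν (D i) ≠ 0) (hν : ∀ i ∈ S, ν (D i) ≠ ∞)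
    (w : ι → ℝ≥0∞) (A : ℝ≥0∞)
    (hw : ∀ j ∈ S, ∀ G ⊆ S, (∀ i ∈ G, D i ⊆ D j) → ∑ i ∈ G, w i ≤ A * ν (D j)) :
    ∑ i ∈ S, ((∫⁻ x in D i, f x ∂ν) / ν (D i)) ^ p * w i ≤
      embeddingConst p * A * ∫⁻ x, f x ^ p ∂ν := by
  classical
  have hp0 : 0 < p := by linarith
  set a : ι → ℝ≥0∞ := fun i => (∫⁻ x in D i, f x ∂ν) / ν (D i) with ha
  -- Each cube is charged to a principal cube `π i` that contains it and has at least half its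
  -- average. The Carleson condition sums the coefficients charged to one principal cube.
  obtain ⟨T, hTS, hcov, hT⟩ := exists_principal D a S
  choose! π hπT hπ using hcov
  have h1 : ∑ i ∈ T, a i ^ p * ν (D i) ≤ geomConst (p - 1) ^ p * ∫⁻ x, f x ^ p ∂ν := by
    refine sum_average_rpow_mul_measure_le hp hD hDm hf T a (fun i hi => hν i (hTS hi))
      (fun i hi => ?_) (fun i hi => ?_) hT
    · exact ENNReal.div_ne_top (setLIntegral_ne_top_of_rpow hp hf hfp (hν i (hTS hi)))
        (hν0 i (hTS hi))
    · exact ENNReal.div_mul_cancel (hν0 i (hTS hi)) (hν i (hTS hi))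
  calc ∑ i ∈ S, a i ^ p * w i
      = ∑ j ∈ T, ∑ i ∈ S.filter (fun i => π i = j), a i ^ p * w i :=
        (Finset.sum_fiberwise_of_maps_to hπT _).symm
    _ ≤ ∑ j ∈ T, ∑ i ∈ S.filter (fun i => π i = j), (2 * a j) ^ p * w i := by
        refine Finset.sum_le_sum fun j _ => Finset.sum_le_sum fun i hi => ?_
        rw [Finset.mem_filter] at hi
        gcongr
        rw [← hi.2]
        exact (hπ i hi.1).2
    _ = ∑ j ∈ T, (2 * a j) ^ p * ∑ i ∈ S.filter (fun i => π i = j), w i := by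
        simp_rw [Finset.mul_sum]
    _ ≤ ∑ j ∈ T, (2 * a j) ^ p * (A * ν (D j)) := by
        refine Finset.sum_le_sum fun j hj => ?_
        gcongr
        refine hw j (hTS hj) _ (Finset.filter_subset _ _) fun i hi => ?_
        rw [Finset.mem_filter] at hi
        rw [← hi.2]
        exact (hπ i hi.1).1
    _ = 2 ^ p * A * ∑ j ∈ T, a j ^ p * ν (D j) := by
        rw [Finset.mul_sum]
        refine Finset.sum_congr rfl fun j _ => ?_
        rw [ENNReal.mul_rpow_of_nonneg _ _ hp0.le]; ring
    _ ≤ 2 ^ p * A * (geomConst (p - 1) ^ p * ∫⁻ x, f x ^ p ∂ν) := by gcongr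
    _ = _ := by rw [embeddingConst]; ring

end Embedding

end PoissonCarleson

namespace PoissonCarleson

variable {n : ℕ}

/-! ### Half-open cubes -/

/-- The half-open cube. -/
def Cube.core (Q : Cube n) : Set (Space n) :=
  {x | ∀ i, Q.corner i ≤ x i ∧ x i < Q.corner i + Q.side}

/-- The cube of the half-space over the half-open cube. -/
def Cube.coreTilde (Q : Cube n) : Set (HalfSpace n) :=
  {z | z.1 ∈ Q.core ∧ z.2 < Q.side}

theorem Cube.core_subset_toSet (Q : Cube n) : Q.core ⊆ Q.toSet :=
  fun _ hx i => ⟨(hx i).1, (hx i).2.le⟩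

theorem Cube.coreTilde_subset_tilde (Q : Cube n) : Q.coreTilde ⊆ Q.tilde :=
  fun _ hz => ⟨Q.core_subset_toSet hz.1, hz.2⟩

theorem Cube.core_eq_preimage (Q : Cube n) : Q.core = (WithLp.ofLp : Space n → (Fin n → ℝ)) ⁻¹'
    (univ.pi fun i => Ico (Q.corner i) (Q.corner i + Q.side)) := by
  ext x; simp [Cube.core]

theorem Cube.toSet_eq_preimage (Q : Cube n) : Q.toSet = (WithLp.ofLp : Space n → (Fin n → ℝ)) ⁻¹'
    (univ.pi fun i => Icc (Q.corner i) (Q.corner i + Q.side)) := by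
  ext x; simp [Cube.toSet, -Set.pi_univ_Icc]

theorem Cube.measurableSet_core (Q : Cube n) : MeasurableSet Q.core := by
  rw [Q.core_eq_preimage]
  exact (PiLp.volume_preserving_ofLp (Fin n)).measurable
    (MeasurableSet.univ_pi fun _ => measurableSet_Ico)

theorem Cube.isClosed_toSet (Q : Cube n) : IsClosed Q.toSet := by
  rw [Q.toSet_eq_preimage]
  exact (isClosed_set_pi fun _ _ => isClosed_Icc).preimage (PiLp.continuous_ofLp 2 _)

theorem Cube.isCompact_toSet (Q : Cube n) : IsCompact Q.toSet := by
  rw [Q.toSet_eq_preimage]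
  exact (PiLp.homeomorph 2 (fun _ : Fin n => ℝ)).isCompact_preimage.2
    (isCompact_univ_pi fun _ => isCompact_Icc)

theorem Cube.measurableSet_toSet (Q : Cube n) : MeasurableSet Q.toSet :=
  Q.isClosed_toSet.measurableSet

theorem Cube.measurableSet_coreTilde (Q : Cube n) : MeasurableSet Q.coreTilde :=
  have h : MeasurableSet {z : HalfSpace n | z.2 < Q.side} :=
    measurableSet_lt measurable_snd measurable_const
  (measurable_fst Q.measurableSet_core).inter h

theorem Cube.volume_core (Q : Cube n) : volume Q.core = (Q.side : ℝ≥0∞) ^ n := by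
  rw [Q.core_eq_preimage, (PiLp.volume_preserving_ofLp (Fin n)).measure_preimage
    (MeasurableSet.univ_pi fun _ => measurableSet_Ico).nullMeasurableSet, Real.volume_pi_Ico]
  simp

theorem Cube.volume_toSet (Q : Cube n) : volume Q.toSet = (Q.side : ℝ≥0∞) ^ n := by
  have h := Real.volume_Icc_pi (a := Q.corner.ofLp) (b := fun i => Q.corner i + Q.side)
  rw [← Set.pi_univ_Icc] at h
  rw [Q.toSet_eq_preimage, (PiLp.volume_preserving_ofLp (Fin n)).measure_preimage
    (MeasurableSet.univ_pi fun _ => measurableSet_Icc).nullMeasurableSet, h]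
  simp

theorem Cube.volume_core_ne_zero (Q : Cube n) : volume Q.core ≠ 0 := by
  rw [Q.volume_core]
  exact pow_ne_zero _ (by exact_mod_cast Q.side_pos.ne')

theorem Cube.volume_core_ne_top (Q : Cube n) : volume Q.core ≠ ∞ := by
  rw [Q.volume_core]
  exact ENNReal.pow_ne_top ENNReal.coe_ne_top

theorem Cube.core_ae_eq_toSet (Q : Cube n) : Q.core =ᵐ[volume] Q.toSet :=
  ae_eq_of_subset_of_measure_ge Q.core_subset_toSet (by rw [Q.volume_core, Q.volume_toSet])
    Q.measurableSet_core.nullMeasurableSet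
    (by rw [Q.volume_toSet, ← Q.volume_core]; exact Q.volume_core_ne_top)

theorem Cube.volume_toSet_eq (Q : Cube n) : volume Q.toSet = volume Q.core := by
  rw [Q.volume_core, Q.volume_toSet]

theorem Cube.corner_mem_core (Q : Cube n) : Q.corner ∈ Q.core :=
  fun i => ⟨le_rfl, by have : (0 : ℝ) < Q.side := Q.side_pos
                       linarith⟩

theorem Cube.core_subset_iff {Q R : Cube n} : Q.core ⊆ R.core ↔
    ∀ i, R.corner i ≤ Q.corner i ∧ Q.corner i + Q.side ≤ R.corner i + R.side := by
  have hQ : (0 : ℝ) < Q.side := Q.side_pos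
  constructor
  · intro h i
    refine ⟨(h Q.corner_mem_core i).1, le_of_forall_lt fun c hc => ?_⟩
    by_cases hc' : c < Q.corner i
    · have := (h Q.corner_mem_core i).2
      linarith
    push Not at hc'
    -- The corner with one coordinate raised to an arbitrary `c` below the right end tests that end
    -- of the half-open cube.
    have hx : WithLp.toLp 2 (Function.update Q.corner.ofLp i c) ∈ Q.core := by
      intro j
      by_cases hj : j = i
      · subst hj; simp [hc, hc']
      · simpa [Function.update_of_ne hj] using Q.side_pos
    simpa using (h hx i).2
  · intro h x hx i
    exact ⟨(h i).1.trans (hx i).1, (hx i).2.trans_le (h i).2⟩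

/-- One coordinate suffices, but one is needed: in dimension zero every cube is the whole space,
whatever its side. -/
theorem Cube.side_le_of_core_subset (hn : 1 ≤ n) {Q R : Cube n} (h : Q.core ⊆ R.core) :
    Q.side ≤ R.side := by
  have := Cube.core_subset_iff.1 h ⟨0, hn⟩
  rw [← NNReal.coe_le_coe]
  linarith [this.1, this.2]

theorem Cube.toSet_subset_of_core_subset {Q R : Cube n} (h : Q.core ⊆ R.core) :
    Q.toSet ⊆ R.toSet := fun x hx i => by
  have := Cube.core_subset_iff.1 h i
  exact ⟨this.1.trans (hx i).1, (hx i).2.trans this.2⟩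

theorem Cube.coreTilde_subset_of_core_subset (hn : 1 ≤ n) {Q R : Cube n} (h : Q.core ⊆ R.core) :
    Q.coreTilde ⊆ R.coreTilde :=
  fun _ hz => ⟨h hz.1, hz.2.trans_le (Cube.side_le_of_core_subset hn h)⟩

theorem Cube.disjoint_coreTilde {Q R : Cube n} (h : Disjoint Q.core R.core) :
    Disjoint Q.coreTilde R.coreTilde :=
  Set.disjoint_left.2 fun _ hz hz' => Set.disjoint_left.1 h hz.1 hz'.1

/-! ### Shifted dyadic grids -/

/-- The index of a dyadic cube: its generation and its position. -/
abbrev GridIndex (n : ℕ) : Type := ℤ × (Fin n → ℤ)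

/-- The relative shift of the grid points of generation `k`. -/
noncomputable def gridShift (b : Bool) (k : ℤ) : ℝ := if b then (-1) ^ k / 3 else 0

/-- The cubes of the dyadic grid with shift pattern `b`. -/
noncomputable def gridCube (b : Fin n → Bool) (i : GridIndex n) : Cube n where
  corner := WithLp.toLp 2 fun j => (2 : ℝ) ^ i.1 * (i.2 j + gridShift (b j) i.1)
  side := 2 ^ i.1
  side_pos := zpow_pos two_pos _

/-- The difference is `(-1)^k ((-2)^d - 1) / 3`, an integer since `-2 ≡ 1` modulo 3. The alternating
sign of the shift is chosen for this: it makes the shifted grids nested. -/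
theorem gridShift_nested (b : Bool) (k : ℤ) (d : ℕ) :
    ∃ N : ℤ, (2 : ℝ) ^ d * gridShift b (k + d) - gridShift b k = N := by
  cases b with
  | false => exact ⟨0, by simp [gridShift]⟩
  | true =>
    obtain ⟨N, hN⟩ : (3 : ℤ) ∣ (-2) ^ d - 1 ^ d :=
      dvd_trans ⟨-1, by norm_num⟩ (sub_dvd_pow_sub_pow (-2 : ℤ) 1 d)
    have hN' : ((-2 : ℝ)) ^ d - 1 = 3 * N := by
      have := congrArg (Int.cast : ℤ → ℝ) hN
      push_cast at this
      rwa [one_pow] at this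
    have e : (-2 : ℝ) ^ d = 2 ^ d * (-1) ^ d := by rw [← mul_pow]; norm_num
    have h1 : (2 : ℝ) ^ d * gridShift true (k + d) - gridShift true k = (-1) ^ k * N := by
      simp only [gridShift, if_true]
      rw [zpow_add₀ (by norm_num), zpow_natCast]
      linear_combination (-1 : ℝ) ^ k / 3 * hN' - (-1 : ℝ) ^ k / 3 * e
    rcases Int.even_or_odd k with hk | hk
    · exact ⟨N, by rw [h1, hk.neg_one_zpow, one_mul]⟩
    · exact ⟨-N, by rw [h1, hk.neg_one_zpow]; push_cast; ring⟩

theorem gridCube_side (b : Fin n → Bool) (i : GridIndex n) :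
    ((gridCube b i).side : ℝ) = 2 ^ i.1 := by simp [gridCube]

theorem gridCube_core_subset (b : Fin n → Bool) {i i' : GridIndex n} (hle : i.1 ≤ i'.1)
    (h : ¬ Disjoint (gridCube b i).core (gridCube b i').core) :
    (gridCube b i).core ⊆ (gridCube b i').core := by
  obtain ⟨x, hx, hx'⟩ := Set.not_disjoint_iff.1 h
  rw [Cube.core_subset_iff]
  intro j
  have h1 := hx j
  have h2 := hx' j
  simp only [gridCube_side] at h1 h2 ⊢
  obtain ⟨k, m⟩ := i
  obtain ⟨k', m'⟩ := i'
  obtain ⟨d, rfl⟩ := Int.le.dest hle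
  obtain ⟨N, hN⟩ := gridShift_nested (b j) k d
  simp only [gridCube] at h1 h2 ⊢
  have hk : (0 : ℝ) < 2 ^ k := by positivity
  have e1 : (2 : ℝ) ^ (k + (d : ℤ)) = 2 ^ k * 2 ^ d := by
    rw [zpow_add₀ (by norm_num), zpow_natCast]
  -- The corner of the coarse cube is a grid point of the finer generation; from here on containment
  -- is a comparison of integers.
  have e2 : (2 : ℝ) ^ (k + (d : ℤ)) * (m' j + gridShift (b j) (k + d)) =
      2 ^ k * ((2 ^ d * m' j + N : ℤ) + gridShift (b j) k) := by
    rw [e1]; push_cast; rw [← hN]; ring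
  rw [e2, e1] at h2 ⊢
  set M : ℤ := 2 ^ d * m' j + N
  set s := gridShift (b j) k
  have a1 : M < m j + 1 := by
    have : (2 : ℝ) ^ k * (M + s) < 2 ^ k * ((m j + 1 : ℤ) + s) := by
      push_cast; linarith [h1.2, h2.1]
    have := lt_of_mul_lt_mul_left this hk.le
    have : (M : ℝ) < (m j + 1 : ℤ) := by linarith
    exact_mod_cast this
  have a2 : m j < M + 2 ^ d := by
    have : (2 : ℝ) ^ k * (m j + s) < 2 ^ k * ((M + 2 ^ d : ℤ) + s) := by
      push_cast; linarith [h1.1, h2.2]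
    have := lt_of_mul_lt_mul_left this hk.le
    have : (m j : ℝ) < (M + 2 ^ d : ℤ) := by linarith
    exact_mod_cast this
  have b1 : (M : ℝ) ≤ m j := by exact_mod_cast Int.lt_add_one_iff.1 a1
  have b2 : (m j : ℝ) + 1 ≤ M + 2 ^ d := by exact_mod_cast a2
  constructor
  · gcongr
  · have := mul_le_mul_of_nonneg_left b2 hk.le
    linarith

theorem gridCube_injective (hn : 1 ≤ n) (b : Fin n → Bool) {i i' : GridIndex n}
    (h : (gridCube b i).core = (gridCube b i').core) : i = i' := by
  have h1 := Cube.core_subset_iff.1 h.subset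
  have h2 := Cube.core_subset_iff.1 h.symm.subset
  simp only [gridCube_side] at h1 h2
  obtain ⟨k, m⟩ := i
  obtain ⟨k', m'⟩ := i'
  have hk : k = k' := by
    have a1 := h1 ⟨0, hn⟩
    have a2 := h2 ⟨0, hn⟩
    refine zpow_right_injective₀ (a := (2 : ℝ)) (by norm_num) (by norm_num) ?_
    exact le_antisymm (by linarith) (by linarith)
  subst hk
  congr 1
  ext j
  have a : (gridCube b (k, m)).corner j = (gridCube b (k, m')).corner j :=
    le_antisymm (h2 j).1 (h1 j).1
  simp only [gridCube] at a
  have := mul_left_cancel₀ (by positivity : (2 : ℝ) ^ k ≠ 0) a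
  exact_mod_cast add_right_cancel this

theorem isLaminar_gridCube (hn : 1 ≤ n) (b : Fin n → Bool) :
    IsLaminar fun i => (gridCube b i).core := by
  intro i j hij
  by_cases hd : Disjoint (gridCube b i).core (gridCube b j).core
  · exact Or.inl hd
  have hne : (gridCube b i).core ≠ (gridCube b j).core := fun h => hij (gridCube_injective hn b h)
  rcases le_total i.1 j.1 with h | h
  · exact Or.inr (Or.inl ((gridCube_core_subset b h hd).ssubset_of_ne hne))
  · exact Or.inr (Or.inr ((gridCube_core_subset b h fun h => hd h.symm).ssubset_of_ne hne.symm))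

/-- The one-third trick: an interval of length `2 * r < 1 / 3` that meets an integer stays away from
all points of the lattice shifted by a third. -/
theorem exists_gridShift_interval (k : ℤ) {u r : ℝ} (hr : 0 < r) (hr' : r < 1 / 6) :
    ∃ b : Bool, ∃ m : ℤ, m + gridShift b k ≤ u - r ∧ u + r < m + 1 + gridShift b k := by
  -- The least integer beyond the left end: either the interval ends before `N` and the unshifted
  -- grid serves, or it contains `N` and the shifted one does.
  set N : ℤ := ⌊u - r⌋ + 1 with hN
  have h1 : (N : ℝ) - 1 ≤ u - r := by rw [hN]; push_cast; linarith [Int.floor_le (u - r)]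
  have h2 : u - r < N := by rw [hN]; push_cast; linarith [Int.lt_floor_add_one (u - r)]
  by_cases hu : u + r < N
  · exact ⟨false, N - 1, by simp [gridShift]; linarith, by simp [gridShift]; linarith⟩
  push Not at hu
  rcases Int.even_or_odd k with hk | hk
  · refine ⟨true, N - 1, ?_, ?_⟩ <;> simp [gridShift, hk.neg_one_zpow] <;> linarith
  · refine ⟨true, N, ?_, ?_⟩ <;> simp [gridShift, hk.neg_one_zpow] <;> linarith

/-- Every ball is contained in a cube of comparable size of one of the shifted grids. -/
theorem exists_gridCube_closedBall_subset (x : Space n) {r : ℝ} (hr : 0 < r) :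
    ∃ (b : Fin n → Bool) (i : GridIndex n), Metric.closedBall x r ⊆ (gridCube b i).core ∧
      r < (gridCube b i).side ∧ ((gridCube b i).side : ℝ) ≤ 12 * r := by
  -- With `2 ^ l ≤ 6 * r < 2 ^ (l + 1)`, the scale `2 ^ (l + 1)` makes the relative radius less than
  -- `1 / 6` while the side is at most `12 * r`.
  obtain ⟨l, hl1, hl2⟩ := exists_mem_Ico_zpow (x := 6 * r) (y := (2 : ℝ)) (by linarith) (by norm_num)
  have hk : (0 : ℝ) < 2 ^ (l + 1) := by positivity
  have hr' : r / 2 ^ (l + 1) < 1 / 6 := by rw [div_lt_iff₀ hk]; linarith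
  choose b m hm1 hm2 using fun j : Fin n =>
    exists_gridShift_interval (l + 1) (u := x j / 2 ^ (l + 1)) (div_pos hr hk) hr'
  refine ⟨b, (l + 1, m), fun y hy j => ?_, ?_, ?_⟩
  · have hyj : |y j - x j| ≤ r := by
      have := EuclideanSpace.norm_eq (y - x)
      have h1 : ‖(y - x) j‖ ≤ ‖y - x‖ := PiLp.norm_apply_le _ _
      rw [Metric.mem_closedBall, dist_eq_norm] at hy
      simpa using h1.trans hy
    rw [abs_le] at hyj
    rw [gridCube_side]
    simp only [gridCube]
    have a1 := mul_le_mul_of_nonneg_left (hm1 j) hk.le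
    have a2 := mul_lt_mul_of_pos_left (hm2 j) hk
    rw [mul_sub, mul_div_cancel₀ _ hk.ne', mul_div_cancel₀ _ hk.ne'] at a1
    rw [mul_add, mul_div_cancel₀ _ hk.ne', mul_div_cancel₀ _ hk.ne'] at a2
    constructor <;> linarith
  · rw [gridCube_side]; dsimp only; linarith
  · rw [gridCube_side]
    dsimp only
    rw [zpow_add₀ (by norm_num), zpow_one]; linarith

end PoissonCarleson

namespace PoissonCarleson

variable {n : ℕ}

/-! ### Domination of the Poisson integral by dyadic averages -/

/-- The normalizing constant of the Poisson kernel. -/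
noncomputable def poissonConst (n : ℕ) : ℝ :=
  Real.Gamma (((n : ℝ) + 1) / 2) / Real.pi ^ (((n : ℝ) + 1) / 2)

theorem poissonConst_nonneg (n : ℕ) : 0 ≤ poissonConst n :=
  div_nonneg (Real.Gamma_nonneg_of_nonneg (by positivity)) (by positivity)

theorem poissonKernel_eq (x : Space n) (t : ℝ≥0) : poissonKernel x t =
    poissonConst n * ((t : ℝ) / (‖x‖ ^ 2 + (t : ℝ) ^ 2) ^ (((n : ℝ) + 1) / 2)) := rfl

theorem poissonKernel_nonneg (x : Space n) (t : ℝ≥0) : 0 ≤ poissonKernel x t :=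
  mul_nonneg (poissonConst_nonneg n) (by positivity)

theorem poissonKernel_zero (x : Space n) : poissonKernel x 0 = 0 := by
  simp [poissonKernel_eq]

theorem poissonKernel_le {x : Space n} {t : ℝ≥0} {A : ℝ} (hA : 0 < A)
    (h : A ^ 2 ≤ ‖x‖ ^ 2 + (t : ℝ) ^ 2) :
    poissonKernel x t ≤ poissonConst n * (t / A ^ (n + 1)) := by
  rw [poissonKernel_eq]
  refine mul_le_mul_of_nonneg_left ?_ (poissonConst_nonneg n)
  refine div_le_div_of_nonneg_left t.2 (by positivity) ?_
  calc A ^ (n + 1) = (A ^ 2) ^ (((n : ℝ) + 1) / 2) := by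
        rw [← Real.rpow_natCast, ← Real.rpow_natCast, ← Real.rpow_mul hA.le]
        congr 1; push_cast; ring
    _ ≤ _ := Real.rpow_le_rpow (by positivity) h (by positivity)

/-- Taking `j` least, `‖x‖² + t²` is at least `(2 ^ j * t / 2)²`: for `j = 0` because of `t`,
otherwise by minimality. The factor `2⁻¹ ^ j` is the decay of the kernel beyond the volume `(2 ^ j *
t) ^ n`. -/
theorem exists_poissonKernel_le (x : Space n) {t : ℝ≥0} (ht : 0 < t) :
    ∃ j : ℕ, ‖x‖ ≤ 2 ^ j * t ∧
      poissonKernel x t ≤ poissonConst n * 2 ^ (n + 1) * (2⁻¹ ^ j * ((2 ^ j * (t : ℝ)) ^ n)⁻¹) := by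
  classical
  have ht' : (0 : ℝ) < t := ht
  have hex : ∃ j : ℕ, ‖x‖ ≤ 2 ^ j * t := by
    obtain ⟨j, hj⟩ := pow_unbounded_of_one_lt (‖x‖ / t) (one_lt_two (α := ℝ))
    exact ⟨j, ((div_lt_iff₀ ht').1 hj).le⟩
  refine ⟨Nat.find hex, Nat.find_spec hex, ?_⟩
  have hlow : (2 ^ Nat.find hex * (t : ℝ) / 2) ^ 2 ≤ ‖x‖ ^ 2 + (t : ℝ) ^ 2 := by
    rcases h : Nat.find hex with _ | j
    · nlinarith [sq_nonneg ‖x‖, sq_nonneg (t : ℝ)]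
    · have h1 : ¬ ‖x‖ ≤ 2 ^ j * t := Nat.find_min hex (by omega)
      push Not at h1
      have h2 : (2 ^ (j + 1) * (t : ℝ) / 2) = 2 ^ j * t := by rw [pow_succ]; ring
      rw [h2]
      have : (2 ^ j * (t : ℝ)) ^ 2 ≤ ‖x‖ ^ 2 := by gcongr
      nlinarith [sq_nonneg (t : ℝ)]
  refine (poissonKernel_le (by positivity) hlow).trans_eq ?_
  generalize Nat.find hex = j
  rw [inv_pow, div_pow, pow_succ (2 ^ j * (t : ℝ)) n]
  field_simp

/-- The Poisson integral of a nonnegative function is dominated by its averages over the dyadic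
cubes of the shifted grids. -/
theorem exists_lintegral_poissonKernel_le (n : ℕ) : ∃ C : ℝ≥0, ∀ (g : Space n → ℝ≥0∞),
    AEMeasurable g → ∀ (z : HalfSpace n) (M : ℝ≥0∞),
    (∀ b i, z ∈ (gridCube b i).coreTilde →
      (∫⁻ y in (gridCube b i).core, g y) / volume (gridCube b i).core ≤ M) →
    ∫⁻ y, ENNReal.ofReal (poissonKernel (z.1 - y) z.2) * g y ≤ C * M := by
  set c : ℝ := poissonConst n * 2 ^ (n + 1) * 12 ^ n with hc
  have hc0 : 0 ≤ c := mul_nonneg (mul_nonneg (poissonConst_nonneg n) (by positivity)) (by positivity)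
  refine ⟨c.toNNReal * 2, fun g hg z M hM => ?_⟩
  obtain ⟨x, t⟩ := z
  rcases eq_or_ne t 0 with rfl | ht0
  · simp [poissonKernel_zero]
  have ht : 0 < t := pos_iff_ne_zero.2 ht0
  have ht' : (0 : ℝ) < t := ht
  choose b i hball hside1 hside2 using fun j : ℕ =>
    exists_gridCube_closedBall_subset x (r := 2 ^ j * (t : ℝ)) (by positivity)
  set R : ℕ → Cube n := fun j => gridCube (b j) (i j) with hR
  -- The index `j` supplied by the kernel bound depends on `y`; passing from that single term to the
  -- whole series removes the dependence.
  have hpt : ∀ y, ENNReal.ofReal (poissonKernel (x - y) t) * g y ≤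
      ∑' j : ℕ, (ENNReal.ofReal c * 2⁻¹ ^ j * (volume (R j).core)⁻¹) *
        (R j).core.indicator g y := by
    intro y
    obtain ⟨j, hj1, hj2⟩ := exists_poissonKernel_le (x - y) ht
    have hy : y ∈ (R j).core := hball j (by
      rw [Metric.mem_closedBall, dist_eq_norm, norm_sub_rev]; exact hj1)
    refine le_trans ?_ (ENNReal.le_tsum j)
    rw [indicator_of_mem hy]
    refine mul_le_mul_left ?_ _
    have hs : (0 : ℝ) < (R j).side := (R j).side_pos
    have h1 : poissonKernel (x - y) t ≤ c * 2⁻¹ ^ j * (((R j).side : ℝ) ^ n)⁻¹ := by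
      refine hj2.trans ?_
      have h2 : ((2 ^ j * (t : ℝ)) ^ n)⁻¹ ≤ 12 ^ n * (((R j).side : ℝ) ^ n)⁻¹ := by
        rw [← div_eq_mul_inv, le_div_iff₀ (by positivity), inv_mul_le_iff₀ (by positivity),
          ← mul_pow]
        gcongr
        linarith [hside2 j]
      calc poissonConst n * 2 ^ (n + 1) * (2⁻¹ ^ j * ((2 ^ j * (t : ℝ)) ^ n)⁻¹)
          ≤ poissonConst n * 2 ^ (n + 1) * (2⁻¹ ^ j * (12 ^ n * (((R j).side : ℝ) ^ n)⁻¹)) := by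
            have := poissonConst_nonneg n
            gcongr
        _ = _ := by rw [hc]; ring
    refine (ENNReal.ofReal_le_ofReal h1).trans_eq ?_
    rw [ENNReal.ofReal_mul (by positivity), ENNReal.ofReal_mul hc0,
      ENNReal.ofReal_inv_of_pos (by positivity), ENNReal.ofReal_pow (by positivity),
      ENNReal.ofReal_pow (by positivity), ENNReal.ofReal_inv_of_pos (by positivity),
      Cube.volume_core, ENNReal.ofReal_coe_nnreal]
    norm_num
  calc ∫⁻ y, ENNReal.ofReal (poissonKernel (x - y) t) * g y
      ≤ ∫⁻ y, ∑' j : ℕ, (ENNReal.ofReal c * 2⁻¹ ^ j * (volume (R j).core)⁻¹) *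
        (R j).core.indicator g y := lintegral_mono hpt
    _ = ∑' j : ℕ, (ENNReal.ofReal c * 2⁻¹ ^ j * (volume (R j).core)⁻¹) *
        ∫⁻ y in (R j).core, g y := by
      rw [lintegral_tsum fun j => (hg.indicator (R j).measurableSet_core).const_mul _]
      congr with j
      rw [lintegral_const_mul'' _ (hg.indicator (R j).measurableSet_core),
        lintegral_indicator (R j).measurableSet_core]
    _ ≤ ∑' j : ℕ, ENNReal.ofReal c * 2⁻¹ ^ j * M := by
      refine ENNReal.tsum_le_tsum fun j => ?_
      rw [mul_assoc]
      refine mul_le_mul_right ?_ _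
      rw [mul_comm, ← div_eq_mul_inv]
      -- The height satisfies `t ≤ 2 ^ j * t < side`, so the tent over the cube contains the point
      -- and the hypothesis on averages applies.
      refine hM (b j) (i j) ⟨hball j (Metric.mem_closedBall_self (by positivity)), ?_⟩
      have h1 : (1 : ℝ) ≤ 2 ^ j := one_le_pow₀ one_le_two
      have h2 : (t : ℝ) < (R j).side := lt_of_le_of_lt (by nlinarith) (hside1 j)
      exact_mod_cast h2
    _ = _ := by
      rw [ENNReal.tsum_mul_right, ENNReal.tsum_mul_left, ENNReal.tsum_geometric,
        ENNReal.one_sub_inv_two, inv_inv]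
      push_cast
      rfl

end PoissonCarleson

namespace PoissonCarleson

variable {n : ℕ}

/-! ### Weights -/

theorem IsWeight.aemeasurable {σ : Space n → ℝ≥0} (hσ : IsWeight σ) : AEMeasurable σ := by
  have h : AEMeasurable (fun x => (σ x : ℝ)) := LocallyIntegrable.aestronglyMeasurable hσ |>.aemeasurable
  simpa using h.real_toNNReal

theorem Cube.mass_eq (Q : Cube n) (σ : Space n → ℝ≥0) : Q.mass σ = weightMeasure σ Q.core := by
  rw [weightMeasure, withDensity_apply _ Q.measurableSet_core, Cube.mass,
    setLIntegral_congr Q.core_ae_eq_toSet]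

theorem Cube.weightMeasure_core_ne_top (Q : Cube n) {σ : Space n → ℝ≥0} (hσ : IsWeight σ) :
    weightMeasure σ Q.core ≠ ∞ := by
  rw [← Q.mass_eq]
  have h : IntegrableOn (fun x => (σ x : ℝ)) Q.toSet :=
    LocallyIntegrable.integrableOn_isCompact hσ Q.isCompact_toSet
  have h2 := h.2
  simpa [HasFiniteIntegral, Cube.mass, enorm_eq_nnnorm, lt_top_iff_ne_top] using h2

theorem Cube.average_congr_of_subset {Q R : Cube n} (h : Q.toSet ⊆ R.toSet)
    {g g' : Space n → ℝ≥0∞} (hg : ∀ x ∈ R.toSet, g x = g' x) : Q.average g = Q.average g' := by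
  rw [Cube.average, Cube.average,
    setLIntegral_congr_fun Q.measurableSet_toSet fun x hx => hg x (h hx)]

theorem Cube.average_restrict {Q R : Cube n} (h : Q.core ⊆ R.core) (σ : Space n → ℝ≥0) :
    Q.average (R.restrict σ) = weightMeasure σ Q.core / volume Q.core := by
  rw [Cube.average_congr_of_subset (Cube.toSet_subset_of_core_subset h)
    (g' := fun y => (σ y : ℝ≥0∞)) (fun x hx => by simp [Cube.restrict, hx]),
    Cube.average, ← Q.mass_eq, Q.volume_toSet_eq, mul_comm, Cube.mass, div_eq_mul_inv]

theorem Cube.density_rpow {p : ℝ} (hp : 1 < p) (Q : Cube n) (a : ℝ≥0∞) :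
    (a / volume Q.core) ^ p = a * (a / volume Q.core) ^ (p - 1) / volume Q.core := by
  calc (a / volume Q.core) ^ p = (a / volume Q.core) ^ (1 + (p - 1)) := by congr 1; ring
    _ = _ := by
      rw [ENNReal.rpow_add_of_nonneg _ _ zero_le_one (by linarith), ENNReal.rpow_one,
        ENNReal.div_eq_inv_mul, ENNReal.div_eq_inv_mul]
      ring

/-! ### Finite sparse families of dyadic cubes -/

section Sparse

/-- The half-open cubes of a grid. -/
noncomputable abbrev gridCore (b : Fin n → Bool) (i : GridIndex n) : Set (Space n) :=
  (gridCube b i).core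

/-- The cubes of the half-space over the cubes of a grid. -/
noncomputable abbrev gridTent (b : Fin n → Bool) (i : GridIndex n) : Set (HalfSpace n) :=
  (gridCube b i).coreTilde

/-- A finite family of dyadic cubes is sparse if the residual parts of its cubes have at least half
of their volume. -/
def IsSparse (b : Fin n → Bool) (S : Finset (GridIndex n)) : Prop :=
  ∀ i ∈ S, volume (gridCore b i) ≤ 2 * volume (residual (gridCore b) (gridCore b) S i)

variable {p : ℝ} {μ : Measure (HalfSpace n)} {σ : Space n → ℝ≥0} {b : Fin n → Bool}
  {S : Finset (GridIndex n)}

/-- Sparseness replaces each volume by twice that of the residual part; these parts are disjoint, so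
the sum becomes an integral. -/
theorem sum_mul_volume_le_lintegral (hn : 1 ≤ n) (hS : IsSparse b S) {G : Finset (GridIndex n)}
    (hG : G ⊆ S) {c : GridIndex n → ℝ≥0∞} {A : Set (Space n)} (hA : ∀ i ∈ G, gridCore b i ⊆ A)
    {h : Space n → ℝ≥0∞} (hc : ∀ i ∈ G, ∀ x ∈ gridCore b i, c i ≤ h x) :
    ∑ i ∈ G, c i * volume (gridCore b i) ≤ 2 * ∫⁻ x in A, h x := by
  calc ∑ i ∈ G, c i * volume (gridCore b i)
      ≤ ∑ i ∈ G, c i * (2 * volume (residual (gridCore b) (gridCore b) S i)) :=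
        Finset.sum_le_sum fun i hi => mul_le_mul_right (hS i (hG hi)) _
    _ = 2 * ∑ i ∈ G, c i * volume (residual (gridCore b) (gridCore b) S i) := by
        rw [Finset.mul_sum]
        exact Finset.sum_congr rfl fun i _ => by ring
    _ ≤ 2 * ∫⁻ x in A, h x := by
        gcongr
        exact sum_mul_measure_residual_le_lintegral (isLaminar_gridCube hn b) (fun _ _ h => h)
          (fun i => (gridCube b i).measurableSet_core) hG hA hc

/-- The coefficient of a cube in the discretized estimate. -/
noncomputable def tentCoeff (p : ℝ) (μ : Measure (HalfSpace n)) (σ : Space n → ℝ≥0)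
    (b : Fin n → Bool) (S : Finset (GridIndex n)) (i : GridIndex n) : ℝ≥0∞ :=
  (weightMeasure σ (gridCore b i) / volume (gridCore b i)) ^ p *
    μ (residual (gridCore b) (gridTent b) S i)

theorem tentCoeff_le (i : GridIndex n) : tentCoeff p μ σ b S i ≤
    (weightMeasure σ (gridCore b i) / volume (gridCore b i)) ^ p * μ (gridCube b i).tilde := by
  rw [tentCoeff]
  exact mul_le_mul_right (measure_mono ((residual_subset _ _ S i).trans
    (Cube.coreTilde_subset_tilde _))) _

/-- The testing condition is a Carleson condition. -/
theorem sum_tentCoeff_le_testing (hn : 1 ≤ n) (hp : 1 < p) (hσ : IsWeight σ)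
    {j : GridIndex n} (hj : weightMeasure σ (gridCore b j) ≠ 0) {G : Finset (GridIndex n)}
    (hG : G ⊆ S) (hGj : ∀ i ∈ G, gridCore b i ⊆ gridCore b j) :
    ∑ i ∈ G, tentCoeff p μ σ b S i ≤ spConst p μ σ ^ p * weightMeasure σ (gridCore b j) := by
  have hp0 : 0 < p := by linarith
  set R := gridCube b j with hR
  have h1 : ∑ i ∈ G, tentCoeff p μ σ b S i ≤
      ∫⁻ z in R.tilde, carlesonMaximal (R.restrict σ) z ^ p ∂μ := by
    refine sum_mul_measure_residual_le_lintegral (isLaminar_gridCube hn b)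
      (fun _ _ h => Cube.disjoint_coreTilde h) (fun i => (gridCube b i).measurableSet_coreTilde)
      hG (fun i hi => ?_) fun i hi z hz => ?_
    · exact (Cube.coreTilde_subset_of_core_subset hn (hGj i hi)).trans R.coreTilde_subset_tilde
    -- For `z` in the tent over a subcube of `R`, that subcube competes in the maximal function of
    -- `σ χ_R`.
    · gcongr
      rw [← Cube.average_restrict (hGj i hi)]
      exact le_iSup_of_le (gridCube b i) (le_iSup_of_le (Cube.core_subset_toSet _ hz.1)
        (le_iSup_of_le hz.2.le le_rfl))
  refine h1.trans ?_
  have h2 : ((∫⁻ z in R.tilde, carlesonMaximal (R.restrict σ) z ^ p ∂μ) / R.mass σ) ^ (1 / p) ≤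
      spConst p μ σ := le_iSup (fun Q : Cube n =>
        ((∫⁻ z in Q.tilde, carlesonMaximal (Q.restrict σ) z ^ p ∂μ) / Q.mass σ) ^ (1 / p)) R
  rw [one_div, ENNReal.rpow_inv_le_iff hp0, R.mass_eq] at h2
  rwa [ENNReal.div_le_iff hj (R.weightMeasure_core_ne_top hσ)] at h2

end Sparse

/-! ### Generalized Hölder inequality -/

section Orlicz

/-- Beyond `c`, convexity and `Θ 0 = 0` force at least linear growth; the summand `1` covers `t ≤
c`. -/
theorem one_le_mul_add_of_convexOn {Θ : ℝ≥0 → ℝ≥0∞} (hΘ : ConvexOn ℝ≥0 univ Θ) (h0 : Θ 0 = 0)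
    {c : ℝ≥0} (hc : 1 ≤ Θ c) (t : ℝ≥0) : (t : ℝ≥0∞) ≤ c * (Θ t + 1) := by
  have hc0 : c ≠ 0 := by rintro rfl; simp [h0] at hc
  rcases le_total t c with h | h
  · calc (t : ℝ≥0∞) ≤ c := by exact_mod_cast h
      _ = c * 1 := (mul_one _).symm
      _ ≤ _ := by gcongr; exact le_add_self
  · have ht0 : t ≠ 0 := fun h' => hc0 (le_antisymm (h'.symm ▸ h) zero_le)
    have hle : c / t ≤ 1 := div_le_one_of_le₀ h zero_le
    have h1 := hΘ.2 (mem_univ t) (mem_univ 0) (show 0 ≤ c / t from zero_le)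
      (show 0 ≤ 1 - c / t from zero_le) (add_tsub_cancel_of_le hle)
    rw [smul_zero, add_zero, h0, smul_zero, add_zero, smul_eq_mul, div_mul_cancel₀ _ ht0,
      ENNReal.smul_def, smul_eq_mul] at h1
    have h2 := hc.trans h1
    calc (t : ℝ≥0∞) = t * 1 := (mul_one _).symm
      _ ≤ t * ((c / t : ℝ≥0) * Θ t) := by gcongr
      _ = c * Θ t := by
        rw [← mul_assoc, ← ENNReal.coe_mul, mul_div_cancel₀ _ ht0]
      _ ≤ _ := by gcongr; exact le_self_add

theorem Cube.average_add_right (Q : Cube n) (g : Space n → ℝ≥0∞) {h : Space n → ℝ≥0∞}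
    (hh : AEMeasurable h) : Q.average (fun y => g y + h y) = Q.average g + Q.average h := by
  rw [Cube.average, lintegral_add_right' _ hh.restrict, mul_add]; rfl

theorem Cube.average_const (Q : Cube n) (c : ℝ≥0∞) : Q.average (fun _ => c) = c := by
  rw [Cube.average, setLIntegral_const, Q.volume_toSet_eq, mul_comm, mul_assoc,
    ENNReal.mul_inv_cancel Q.volume_core_ne_zero Q.volume_core_ne_top, mul_one]

theorem Cube.average_mono (Q : Cube n) {g h : Space n → ℝ≥0∞} (hgh : ∀ y, g y ≤ h y) :
    Q.average g ≤ Q.average h := mul_le_mul_right (lintegral_mono hgh) _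

theorem Cube.average_const_mul (Q : Cube n) (c : ℝ≥0) (g : Space n → ℝ≥0∞) :
    Q.average (fun y => c * g y) = c * Q.average g := by
  rw [Cube.average, lintegral_const_mul' _ _ ENNReal.coe_ne_top, Cube.average]; ring

/-- The linear minorant of `Θ` bounds the norm below by a multiple of the plain average. This
excludes the product `0 · ∞` in the generalized Hölder inequality. -/
theorem luxemburg_ne_zero {Θ : ℝ≥0 → ℝ≥0∞} (hΘ : ConvexOn ℝ≥0 univ Θ) (h0 : Θ 0 = 0)
    {c : ℝ≥0} (hc : 1 ≤ Θ c) {h : Space n → ℝ≥0} {Q : Cube n}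
    (hQ : Q.average (fun y => (h y : ℝ≥0∞)) ≠ 0) : luxemburg Θ h Q ≠ 0 := by
  have hc0 : c ≠ 0 := by rintro rfl; simp [h0] at hc
  have key : Q.average (fun y => (h y : ℝ≥0∞)) / (2 * c) ≤ luxemburg Θ h Q := by
    refine le_iInf fun r => le_iInf fun hr => le_iInf fun hadm => ?_
    refine ENNReal.div_le_of_le_mul ?_
    calc Q.average (fun y => (h y : ℝ≥0∞))
        ≤ Q.average (fun y => (r * c : ℝ≥0) * (Θ (h y / r) + 1)) := by
          refine Q.average_mono fun y => ?_
          have := one_le_mul_add_of_convexOn hΘ h0 hc (h y / r)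
          calc (h y : ℝ≥0∞) = r * (h y / r : ℝ≥0) := by
                rw [← ENNReal.coe_mul, mul_div_cancel₀ _ hr.ne']
            _ ≤ r * (c * (Θ (h y / r) + 1)) := by gcongr
            _ = _ := by push_cast; ring
      _ = (r * c : ℝ≥0) * (Q.average (fun y => Θ (h y / r)) + 1) := by
          rw [Q.average_const_mul, Q.average_add_right _ aemeasurable_const, Q.average_const]
      _ ≤ (r * c : ℝ≥0) * (1 + 1) := by gcongr
      _ = _ := by push_cast; ring
  intro hl
  rw [hl, nonpos_iff_eq_zero, ENNReal.div_eq_zero_iff] at key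
  rcases key with h | h
  · exact hQ h
  · exact ENNReal.mul_ne_top (by simp) ENNReal.coe_ne_top h

theorem IsYoung.convexOn_coe {Φ : ℝ≥0 → ℝ≥0} (hΦ : IsYoung Φ) :
    ConvexOn ℝ≥0 univ fun s => (Φ s : ℝ≥0∞) :=
  ⟨convex_univ, fun x hx y hy a b ha hb hab => by
    have := hΦ.convex.2 hx hy ha hb hab
    simp only [ENNReal.smul_def, smul_eq_mul] at this ⊢
    exact_mod_cast this⟩

theorem IsYoung.exists_one_le {Φ : ℝ≥0 → ℝ≥0} (hΦ : IsYoung Φ) :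
    ∃ c : ℝ≥0, (1 : ℝ≥0∞) ≤ Φ c := by
  obtain ⟨c, hc⟩ := (hΦ.tendsto.eventually_ge_atTop 1).exists
  exact ⟨c, by exact_mod_cast hc⟩

theorem IsYoung.exists_pos_le_one {Φ : ℝ≥0 → ℝ≥0} (hΦ : IsYoung Φ) :
    ∃ s : ℝ≥0, 0 < s ∧ Φ s ≤ 1 := by
  have h : ∀ᶠ s in nhds (0 : ℝ≥0), Φ s < 1 :=
    hΦ.continuous.continuousAt.eventually_lt_const (by rw [hΦ.map_zero]; exact zero_lt_one)
  obtain ⟨s, hs, hs'⟩ := (h.filter_mono nhdsWithin_le_nhds |>.and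
    (self_mem_nhdsWithin (a := (0 : ℝ≥0)) (s := Ioi 0))).exists
  exact ⟨s, hs', hs.le⟩

/-- Since `Φ⁻¹(1) > 0`, the upper bound on the product of the inverses makes `Ψ⁻¹(1)` finite, and
any `c` above it serves. -/
theorem IsComplementary.exists_one_le {Φ : ℝ≥0 → ℝ≥0} {Ψ : ℝ≥0 → ℝ≥0∞} (hΦ : IsYoung Φ)
    (h : IsComplementary Φ Ψ) : ∃ c : ℝ≥0, 1 ≤ Ψ c := by
  obtain ⟨s, hs, hs1⟩ := hΦ.exists_pos_le_one
  have h1 : (s : ℝ≥0∞) ≤ youngInv (fun s => (Φ s : ℝ≥0∞)) 1 :=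
    le_iSup₂_of_le s (show (Φ s : ℝ≥0∞) ≤ _ by exact_mod_cast hs1) le_rfl
  have h2 : youngInv Ψ 1 ≠ ∞ := by
    intro ht
    have h3 := h.mul_le 1
    rw [ht, ENNReal.mul_top (ne_of_gt (lt_of_lt_of_le (by exact_mod_cast hs) h1))] at h3
    simp at h3
  obtain ⟨c, hc⟩ := ENNReal.lt_iff_exists_nnreal_btwn.1 (lt_top_iff_ne_top.2 h2)
  refine ⟨c, ?_⟩
  by_contra! hlt
  have : (c : ℝ≥0∞) ≤ youngInv Ψ 1 := le_iSup₂_of_le c (by simpa using hlt.le) le_rfl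
  exact absurd hc.1 (not_lt.2 this)

/-- Young's inequality. -/
theorem IsComplementary.mul_le_add {Φ : ℝ≥0 → ℝ≥0} {Ψ : ℝ≥0 → ℝ≥0∞} (h : IsComplementary Φ Ψ)
    (s t : ℝ≥0) : (s : ℝ≥0∞) * t ≤ 2 * (Ψ t + Φ s) := by
  by_cases ht : Ψ t = ∞
  · simp [ht]
  lift Ψ t to ℝ≥0 using ht with q hq
  -- At level `m` both `s` and `t` compete in the respective inverses, so the bound on their product
  -- applies.
  set m := max (Φ s) q with hm
  have h1 : (s : ℝ≥0∞) ≤ youngInv (fun s => (Φ s : ℝ≥0∞)) m :=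
    le_iSup₂_of_le s (ENNReal.coe_le_coe.2 (le_max_left _ _)) le_rfl
  have h2 : (t : ℝ≥0∞) ≤ youngInv Ψ m :=
    le_iSup₂_of_le t (by rw [← hq]; exact_mod_cast le_max_right _ _) le_rfl
  calc (s : ℝ≥0∞) * t ≤ _ := mul_le_mul' h1 h2
    _ ≤ 2 * (m : ℝ≥0∞) := h.mul_le m
    _ ≤ _ := by
      gcongr
      rw [hm, ← ENNReal.coe_add]
      exact_mod_cast max_le le_add_self le_self_add

/-- The generalized Hölder inequality, applied to the factors of a weight. -/
theorem average_le_four_mul_luxemburg {p : ℝ} (hp : 1 < p) {σ : Space n → ℝ≥0}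
    (hσ : AEMeasurable σ) {Φ : ℝ≥0 → ℝ≥0} {Ψ : ℝ≥0 → ℝ≥0∞} (hΦ : IsYoung Φ)
    (h : IsComplementary Φ Ψ) (Q : Cube n) :
    Q.average (fun y => (σ y : ℝ≥0∞)) ≤
      4 * (luxemburg (fun s => (Φ s : ℝ≥0∞)) (fun x => σ x ^ (1 / p.conjExponent)) Q *
        luxemburg Ψ (fun x => σ x ^ (1 / p)) Q) := by
  have hpq := Real.HolderConjugate.conjExponent hp
  have hp0 : 0 < p := hpq.pos
  have hq0 : 0 < p.conjExponent := hpq.symm.pos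
  set u : Space n → ℝ≥0 := fun x => σ x ^ (1 / p.conjExponent) with hu
  set v : Space n → ℝ≥0 := fun x => σ x ^ (1 / p) with hv
  have huv : ∀ y, u y * v y = σ y := by
    intro y
    rw [hu, hv]
    dsimp only
    have e : 1 / p.conjExponent + 1 / p = 1 := by
      have := hpq.inv_add_inv_eq_one
      rw [one_div, one_div, add_comm, this]
    rw [← NNReal.rpow_add_of_nonneg _ (by positivity) (by positivity), e, NNReal.rpow_one]
  by_cases hz : Q.average (fun y => (σ y : ℝ≥0∞)) = 0
  · rw [hz]; exact zero_le
  have hnz : ∀ r : ℝ, 0 < r → Q.average (fun y => ((σ y ^ r : ℝ≥0) : ℝ≥0∞)) ≠ 0 := by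
    intro r hr h0
    refine hz ?_
    have hinv : (volume Q.toSet)⁻¹ ≠ 0 := by
      rw [Q.volume_toSet_eq]; exact ENNReal.inv_ne_zero.2 Q.volume_core_ne_top
    rw [Cube.average, mul_eq_zero, or_iff_right hinv,
      lintegral_eq_zero_iff' (by fun_prop)] at h0
    rw [Cube.average, mul_eq_zero, or_iff_right hinv, lintegral_eq_zero_iff' (by fun_prop)]
    filter_upwards [h0] with y hy
    simpa [NNReal.rpow_eq_zero_iff, hr.ne'] using hy
  obtain ⟨c₁, hc₁⟩ := hΦ.exists_one_le
  obtain ⟨c₂, hc₂⟩ := IsComplementary.exists_one_le hΦ h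
  have hL1 : luxemburg (fun s => (Φ s : ℝ≥0∞)) u Q ≠ 0 :=
    luxemburg_ne_zero hΦ.convexOn_coe (by simp [hΦ.map_zero]) hc₁ (hnz _ (by positivity))
  have hL2 : luxemburg Ψ v Q ≠ 0 :=
    luxemburg_ne_zero h.convex h.map_zero hc₂ (hnz _ (by positivity))
  -- For admissible `r` and `s`, Young's inequality averaged over `Q` gives `4 = 2 * (1 + 1)`. The
  -- infima over `r` and `s` are then taken one at a time, by division.
  have hrs : ∀ r s : ℝ≥0, 0 < r → 0 < s → Q.average (fun y => (Φ (u y / r) : ℝ≥0∞)) ≤ 1 →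
      Q.average (fun y => Ψ (v y / s)) ≤ 1 →
      Q.average (fun y => (σ y : ℝ≥0∞)) ≤ 4 * (r * s) := by
    intro r s hr hs h1 h2
    have hm : AEMeasurable fun y => (Φ (u y / r) : ℝ≥0∞) := by
      have := hΦ.continuous.measurable
      fun_prop
    calc Q.average (fun y => (σ y : ℝ≥0∞))
        ≤ Q.average (fun y => (2 * (r * s) : ℝ≥0) * (Ψ (v y / s) + Φ (u y / r))) := by
          refine Q.average_mono fun y => ?_
          calc (σ y : ℝ≥0∞) = (r * s) * ((u y / r : ℝ≥0) * (v y / s : ℝ≥0)) := by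
                rw [← huv y, ← ENNReal.coe_mul, ← ENNReal.coe_mul, ← ENNReal.coe_mul]
                congr 1
                field_simp
            _ ≤ (r * s) * (2 * (Ψ (v y / s) + Φ (u y / r))) := by
                exact mul_le_mul_right (h.mul_le_add _ _) _
            _ = _ := by push_cast; ring
      _ = (2 * (r * s) : ℝ≥0) * (Q.average (fun y => Ψ (v y / s)) +
            Q.average (fun y => (Φ (u y / r) : ℝ≥0∞))) := by
          rw [Q.average_const_mul, Q.average_add_right _ hm]
      _ ≤ (2 * (r * s) : ℝ≥0) * (1 + 1) := by gcongr
      _ = _ := by push_cast; ring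
  by_cases hL2t : luxemburg Ψ v Q = ∞
  · rw [hL2t, ENNReal.mul_top hL1]; simp
  have key : Q.average (fun y => (σ y : ℝ≥0∞)) / (4 * luxemburg Ψ v Q) ≤
      luxemburg (fun s => (Φ s : ℝ≥0∞)) u Q := by
    refine le_iInf fun r => le_iInf fun hr => le_iInf fun h1 => ?_
    refine ENNReal.div_le_of_le_mul ?_
    have h3 : Q.average (fun y => (σ y : ℝ≥0∞)) / (4 * r) ≤ luxemburg Ψ v Q := by
      refine le_iInf fun s => le_iInf fun hs => le_iInf fun h2 => ?_
      refine ENNReal.div_le_of_le_mul ((hrs r s hr hs h1 h2).trans_eq (by ring))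
    rw [ENNReal.div_le_iff (by simpa using hr.ne') (ENNReal.mul_ne_top (by simp) (by simp))] at h3
    exact h3.trans_eq (by ring)
  rw [ENNReal.div_le_iff (by simpa using hL2) (ENNReal.mul_ne_top (by simp) hL2t)] at key
  exact key.trans_eq (by ring)

end Orlicz

end PoissonCarleson

namespace PoissonCarleson

variable {n : ℕ}

/-! ### Carleson conditions for the bump and entropy constants -/

section Carleson

variable {p : ℝ} {μ : Measure (HalfSpace n)} {σ : Space n → ℝ≥0} {b : Fin n → Bool}
  {S : Finset (GridIndex n)}

theorem Cube.average_weight (Q : Cube n) (σ : Space n → ℝ≥0) :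
    Q.average (fun y => (σ y : ℝ≥0∞)) = weightMeasure σ Q.core / volume Q.core := by
  rw [Cube.average, ← Q.mass_eq, Q.volume_toSet_eq, mul_comm, Cube.mass, div_eq_mul_inv]

theorem luxemburg_indicator {Q R : Cube n} (h : Q.toSet ⊆ R.toSet) {Θ : ℝ≥0 → ℝ≥0∞}
    (g : Space n → ℝ≥0) : luxemburg Θ (R.toSet.indicator g) Q = luxemburg Θ g Q := by
  have : ∀ r : ℝ≥0, Q.average (fun y => Θ (R.toSet.indicator g y / r)) =
      Q.average (fun y => Θ (g y / r)) := fun r =>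
    Cube.average_congr_of_subset h fun x hx => by rw [indicator_of_mem hx]
  simp only [luxemburg, this]

theorem measure_tilde_mul_le_bumpConst (p : ℝ) (μ : Measure (HalfSpace n)) (σ : Space n → ℝ≥0)
    (Θ : ℝ≥0 → ℝ≥0∞) (Q : Cube n) :
    μ Q.tilde * luxemburg Θ (fun x => σ x ^ (1 / p.conjExponent)) Q ^ p ≤
      bumpConst p μ σ Θ * volume Q.core := by
  have h : μ Q.tilde / volume Q.toSet *
      luxemburg Θ (fun x => σ x ^ (1 / p.conjExponent)) Q ^ p ≤ bumpConst p μ σ Θ :=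
    le_iSup (fun Q : Cube n => μ Q.tilde / volume Q.toSet *
      luxemburg Θ (fun x => σ x ^ (1 / p.conjExponent)) Q ^ p) Q
  rw [Q.volume_toSet_eq] at h
  rw [← ENNReal.div_le_iff Q.volume_core_ne_zero Q.volume_core_ne_top]
  refine le_trans (le_of_eq ?_) h
  simp only [div_eq_mul_inv]; ring

/-- The bump condition implies a Carleson condition. -/
theorem sum_tentCoeff_le_bump (hn : 1 ≤ n) (hp : 1 < p) (hσ : IsWeight σ) {Φ : ℝ≥0 → ℝ≥0}
    {Ψ : ℝ≥0 → ℝ≥0∞} (hΦ : IsYoung Φ) (hΨ : IsComplementary Φ Ψ) (hS : IsSparse b S)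
    {j : GridIndex n} (hj : weightMeasure σ (gridCore b j) ≠ 0) {G : Finset (GridIndex n)}
    (hG : G ⊆ S) (hGj : ∀ i ∈ G, gridCore b i ⊆ gridCore b j) :
    ∑ i ∈ G, tentCoeff p μ σ b S i ≤
      4 ^ p * 2 * (bumpConst p μ σ (fun s => (Φ s : ℝ≥0∞)) * wpConst p σ Ψ) *
        weightMeasure σ (gridCore b j) := by
  have hp0 : 0 < p := by linarith
  set R := gridCube b j with hR
  set B := bumpConst p μ σ fun s => (Φ s : ℝ≥0∞) with hB
  set L : GridIndex n → ℝ≥0∞ := fun i => luxemburg Ψ (fun x => σ x ^ (1 / p)) (gridCube b i) with hL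
  set h : Space n → ℝ≥0∞ :=
    fun x => orliczMaximal Ψ (R.toSet.indicator fun y => σ y ^ (1 / p)) x ^ p with hh
  -- Of the two Orlicz factors of the density, the `Φ`-norm is paid for by the bump constant
  -- together with the measure of the tent; only the `Ψ`-norm and the volume remain.
  have h1 : ∀ i, tentCoeff p μ σ b S i ≤ 4 ^ p * B * (L i ^ p * volume (gridCore b i)) := by
    intro i
    have hH := average_le_four_mul_luxemburg hp hσ.aemeasurable hΦ hΨ (gridCube b i)
    rw [Cube.average_weight] at hH
    have hb := measure_tilde_mul_le_bumpConst p μ σ (fun s => (Φ s : ℝ≥0∞)) (gridCube b i)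
    calc tentCoeff p μ σ b S i
        ≤ (weightMeasure σ (gridCore b i) / volume (gridCore b i)) ^ p *
          μ (gridCube b i).tilde := tentCoeff_le i
      _ ≤ (4 * (luxemburg (fun s => (Φ s : ℝ≥0∞)) (fun x => σ x ^ (1 / p.conjExponent))
            (gridCube b i) * L i)) ^ p * μ (gridCube b i).tilde := by gcongr
      _ = 4 ^ p * L i ^ p * (μ (gridCube b i).tilde * luxemburg (fun s => (Φ s : ℝ≥0∞))
            (fun x => σ x ^ (1 / p.conjExponent)) (gridCube b i) ^ p) := by
          rw [ENNReal.mul_rpow_of_nonneg _ _ hp0.le, ENNReal.mul_rpow_of_nonneg _ _ hp0.le]; ring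
      _ ≤ 4 ^ p * L i ^ p * (B * volume (gridCore b i)) := by gcongr
      _ = _ := by ring
  have h2 : ∑ i ∈ G, L i ^ p * volume (gridCore b i) ≤ 2 * ∫⁻ x in R.toSet, h x := by
    refine sum_mul_volume_le_lintegral hn hS hG
      (fun i hi => (hGj i hi).trans R.core_subset_toSet) fun i hi x hx => ?_
    simp only [hh, hL]
    gcongr
    rw [← luxemburg_indicator (Cube.toSet_subset_of_core_subset (hGj i hi))]
    exact le_iSup₂_of_le (gridCube b i) (Cube.core_subset_toSet _ hx) le_rfl
  have h3 : ∫⁻ x in R.toSet, h x ≤ wpConst p σ Ψ * weightMeasure σ (gridCore b j) := by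
    have : (∫⁻ x in R.toSet, h x) / R.mass σ ≤ wpConst p σ Ψ := le_iSup (fun Q : Cube n =>
      (∫⁻ x in Q.toSet, orliczMaximal Ψ (Q.toSet.indicator fun y => σ y ^ (1 / p)) x ^ p) /
        Q.mass σ) R
    rw [R.mass_eq] at this
    rwa [ENNReal.div_le_iff hj (R.weightMeasure_core_ne_top hσ)] at this
  calc ∑ i ∈ G, tentCoeff p μ σ b S i
      ≤ ∑ i ∈ G, 4 ^ p * B * (L i ^ p * volume (gridCore b i)) :=
        Finset.sum_le_sum fun i _ => h1 i
    _ = 4 ^ p * B * ∑ i ∈ G, L i ^ p * volume (gridCore b i) := by rw [Finset.mul_sum]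
    _ ≤ 4 ^ p * B * (2 * (wpConst p σ Ψ * weightMeasure σ (gridCore b j))) := by
        gcongr; exact h2.trans (by gcongr)
    _ = _ := by ring

/-- `Q` itself competes in the maximal function of `σ χ_Q` at each of its points. So the levels `ρ ~
2 ^ k` need only `k ≥ 0`. -/
theorem Cube.one_le_rho (hσ : IsWeight σ) (Q : Cube n) (hQ : weightMeasure σ Q.core ≠ 0) :
    1 ≤ Q.rho σ := by
  rw [Cube.rho, Q.mass_eq,
    ENNReal.le_div_iff_mul_le (Or.inl hQ) (Or.inl (Q.weightMeasure_core_ne_top hσ)), one_mul]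
  calc weightMeasure σ Q.core
      = ∫⁻ _ in Q.toSet, weightMeasure σ Q.core / volume Q.core := by
        rw [setLIntegral_const, Q.volume_toSet_eq,
          ENNReal.div_mul_cancel Q.volume_core_ne_zero Q.volume_core_ne_top]
    _ ≤ ∫⁻ x in Q.toSet, hardyLittlewood (Q.restrict σ) x := by
        refine setLIntegral_mono' Q.measurableSet_toSet fun x hx => ?_
        rw [← Cube.average_restrict (Q := Q) Subset.rfl]
        exact le_iSup₂_of_le Q hx le_rfl

/-- The mass of a cube is its density times its volume, and the density is at most `M(σ χ_R)` on
that cube; sparseness does the rest. -/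
theorem sum_weightMeasure_le_rho (hn : 1 ≤ n) (hσ : IsWeight σ) (hS : IsSparse b S)
    {j : GridIndex n} (hj : weightMeasure σ (gridCore b j) ≠ 0) {G : Finset (GridIndex n)}
    (hG : G ⊆ S) (hGj : ∀ i ∈ G, gridCore b i ⊆ gridCore b j) :
    ∑ i ∈ G, weightMeasure σ (gridCore b i) ≤
      2 * (gridCube b j).rho σ * weightMeasure σ (gridCore b j) := by
  set R := gridCube b j with hR
  calc ∑ i ∈ G, weightMeasure σ (gridCore b i)
      = ∑ i ∈ G, weightMeasure σ (gridCore b i) / volume (gridCore b i) *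
          volume (gridCore b i) := Finset.sum_congr rfl fun i _ =>
        (ENNReal.div_mul_cancel (Cube.volume_core_ne_zero _) (Cube.volume_core_ne_top _)).symm
    _ ≤ 2 * ∫⁻ x in R.toSet, hardyLittlewood (R.restrict σ) x := by
        refine sum_mul_volume_le_lintegral hn hS hG
          (fun i hi => (hGj i hi).trans R.core_subset_toSet) fun i hi x hx => ?_
        rw [← Cube.average_restrict (hGj i hi)]
        exact le_iSup₂_of_le (gridCube b i) (Cube.core_subset_toSet _ hx) le_rfl
    _ = 2 * (R.rho σ * weightMeasure σ (gridCore b j)) := by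
        rw [Cube.rho, R.mass_eq, ENNReal.div_mul_cancel hj (R.weightMeasure_core_ne_top hσ)]
    _ = _ := by ring

/-- The dyadic form of the normalization of an entropy function. -/
theorem IsEntropyFunction.tsum_le {ε : ℝ → ℝ} (hε : IsEntropyFunction ε) :
    ∑' k : ℕ, (ENNReal.ofReal (ε (2 ^ k)))⁻¹ ≤ 2 := by
  set g : ℝ → ℝ≥0∞ := fun t => (ENNReal.ofReal (ε t * t))⁻¹ with hg
  -- For `k = 0` the interval starts at `1 / 2`, the lower limit of the integral. On each interval
  -- `ε(t) t ≤ ε(2 ^ k) 2 ^ k`, and its length is half of `2 ^ k`; this is the factor two.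
  set I : ℕ → Set ℝ := fun k => Ioc (2 ^ k / 2 : ℝ) (2 ^ k) with hI
  have hdisj : Pairwise fun k l => Disjoint (I k) (I l) := by
    have : ∀ k l : ℕ, k < l → Disjoint (I k) (I l) := by
      intro k l hkl
      refine Set.disjoint_left.2 fun x hx hx' => ?_
      have h1 : (2 : ℝ) ^ (k + 1) ≤ 2 ^ l := pow_le_pow_right₀ one_le_two hkl
      rw [pow_succ] at h1
      have h2 := hx.2
      have h3 := hx'.1
      linarith
    intro k l hkl
    rcases lt_or_gt_of_ne hkl with h | h
    · exact this k l h
    · exact (this l k h).symm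
  have hone : ∀ k : ℕ, (1 : ℝ) ≤ 2 ^ k := fun k => one_le_pow₀ one_le_two
  have hterm : ∀ k : ℕ, (ENNReal.ofReal (ε (2 ^ k)))⁻¹ ≤ 2 * ∫⁻ t in I k, g t := by
    intro k
    have hk : (0 : ℝ) < 2 ^ k := by positivity
    have h1 : ∀ t ∈ I k, (ENNReal.ofReal (ε (2 ^ k) * 2 ^ k))⁻¹ ≤ g t := by
      intro t ht
      have ht2 : (1 / 2 : ℝ) ≤ t := by linarith [ht.1, hone k]
      refine ENNReal.inv_le_inv.2 ?_
      have hmon : ε t ≤ ε (2 ^ k) := hε.mono ht2 (show (1 / 2 : ℝ) ≤ 2 ^ k by linarith [hone k]) ht.2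
      rw [ENNReal.ofReal_mul' (by linarith), ENNReal.ofReal_mul' hk.le]
      exact mul_le_mul' (ENNReal.ofReal_le_ofReal hmon) (ENNReal.ofReal_le_ofReal ht.2)
    have h2 := setLIntegral_mono' (μ := volume) measurableSet_Ioc h1
    rw [setLIntegral_const, Real.volume_Ioc, ENNReal.ofReal_mul' hk.le,
      ENNReal.mul_inv (Or.inr ENNReal.ofReal_ne_top)
        (Or.inr (by simp)), mul_assoc] at h2
    have h3 : (ENNReal.ofReal (2 ^ k))⁻¹ * ENNReal.ofReal (2 ^ k - 2 ^ k / 2) = 2⁻¹ := by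
      have e : (2 : ℝ) ^ k - 2 ^ k / 2 = 2 ^ k * 2⁻¹ := by ring
      rw [e, ENNReal.ofReal_mul hk.le, ← mul_assoc,
        ENNReal.inv_mul_cancel (by simp) ENNReal.ofReal_ne_top, one_mul,
        ENNReal.ofReal_inv_of_pos two_pos]
      simp
    rw [h3] at h2
    calc (ENNReal.ofReal (ε (2 ^ k)))⁻¹ = 2 * ((ENNReal.ofReal (ε (2 ^ k)))⁻¹ * 2⁻¹) := by
          rw [mul_comm, mul_assoc, ENNReal.inv_mul_cancel (by simp) (by simp), mul_one]
      _ ≤ _ := by gcongr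
  calc ∑' k : ℕ, (ENNReal.ofReal (ε (2 ^ k)))⁻¹ ≤ ∑' k : ℕ, 2 * ∫⁻ t in I k, g t :=
        ENNReal.tsum_le_tsum hterm
    _ = 2 * ∫⁻ t in ⋃ k, I k, g t := by
        rw [ENNReal.tsum_mul_left, lintegral_iUnion (fun k => measurableSet_Ioc) hdisj]
    _ ≤ 2 * ∫⁻ t in Ioi (1 / 2 : ℝ), g t := by
        gcongr
        refine iUnion_subset fun k t ht => ?_
        have h1 := ht.1
        have h2 := hone k
        exact lt_of_le_of_lt (by linarith) h1
    _ = 2 := by rw [hε.integral_eq, mul_one]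

/-- Of the `p` powers of the density, `p - 1` enter the entropy constant; the last one turns the
volume into the mass `σ(Q)`. For infinite `rhoEps` the coefficient is forced to vanish. -/
theorem tentCoeff_le_entropy (hp : 1 < p) {ε : ℝ → ℝ} {N : ℝ≥0∞} (hN : entropyConst p μ σ ε ≤ N)
    (hNt : N ≠ ∞) {i : GridIndex n} (h0 : (gridCube b i).rhoEps σ ε ≠ 0) :
    tentCoeff p μ σ b S i ≤
      N * ((gridCube b i).rhoEps σ ε)⁻¹ * weightMeasure σ (gridCore b i) := by
  set Q := gridCube b i with hQ
  have h : Q.rhoEps σ ε * (Q.mass σ / volume Q.toSet) ^ (p - 1) * (μ Q.tilde / volume Q.toSet) ≤ N :=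
    le_trans (le_iSup (fun Q : Cube n => Q.rhoEps σ ε * (Q.mass σ / volume Q.toSet) ^ (p - 1)
      * (μ Q.tilde / volume Q.toSet)) Q) hN
  rw [Q.volume_toSet_eq, Q.mass_eq, mul_assoc, mul_comm,
    ← ENNReal.le_div_iff_mul_le (Or.inl h0) (Or.inr hNt), div_eq_mul_inv N] at h
  calc tentCoeff p μ σ b S i
      ≤ (weightMeasure σ Q.core / volume Q.core) ^ p * μ Q.tilde := tentCoeff_le i
    _ = (weightMeasure σ Q.core / volume Q.core) ^ (p - 1) * (μ Q.tilde / volume Q.core) *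
        weightMeasure σ Q.core := by
      rw [Q.density_rpow hp, div_eq_mul_inv (μ Q.tilde), div_eq_mul_inv (_ * _)]; ring
    _ ≤ _ := by gcongr

/-- The discretized estimate for the entropy constant. -/
theorem sum_average_mul_tentCoeff_le_entropy (hn : 1 ≤ n) (hp : 1 < p) (hσ : IsWeight σ)
    {ε : ℝ → ℝ} (hε : IsEntropyFunction ε) (hN : entropyConst p μ σ ε ≠ ∞) (hS : IsSparse b S)
    (hS0 : ∀ i ∈ S, weightMeasure σ (gridCore b i) ≠ 0) {f : Space n → ℝ≥0∞}
    (hf : AEMeasurable f (weightMeasure σ)) (hfp : ∫⁻ x, f x ^ p ∂weightMeasure σ ≠ ∞) :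
    ∑ i ∈ S, ((∫⁻ x in gridCore b i, f x ∂weightMeasure σ) / weightMeasure σ (gridCore b i)) ^ p *
        tentCoeff p μ σ b S i ≤
      embeddingConst p * (8 * entropyConst p μ σ ε) * ∫⁻ x, f x ^ p ∂weightMeasure σ := by
  classical
  set N := entropyConst p μ σ ε with hNdef
  set ν := weightMeasure σ with hν
  set F := ∫⁻ x, f x ^ p ∂ν with hF
  set X : GridIndex n → ℝ≥0∞ := fun i => (∫⁻ x in gridCore b i, f x ∂ν) / ν (gridCore b i) with hX
  set e : ℕ → ℝ≥0∞ := fun k => (ENNReal.ofReal (ε (2 ^ k)))⁻¹ with he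
  have hsum : ∑' k, e k ≤ 2 := hε.tsum_le
  have he_top : ∀ k, e k ≠ ∞ := fun k =>
    ne_top_of_le_ne_top (by simp) ((ENNReal.le_tsum k).trans hsum)
  have hlevel : ∀ i ∈ S, (gridCube b i).rho σ ≠ ∞ →
      ∃ k : ℕ, (2 : ℝ≥0∞) ^ k ≤ (gridCube b i).rho σ ∧ (gridCube b i).rho σ ≤ 2 ^ (k + 1) := by
    intro i hi ht
    have h1 := Cube.one_le_rho hσ (gridCube b i) (hS0 i hi)
    lift (gridCube b i).rho σ to ℝ≥0 using ht with r hr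
    obtain ⟨k, hk1, hk2⟩ := exists_nat_pow_near (x := r) (y := 2) (by exact_mod_cast h1) one_lt_two
    exact ⟨k, by exact_mod_cast hk1, by exact_mod_cast hk2.le⟩
  choose! κ hκ1 hκ2 using hlevel
  have hcoeff : ∀ i ∈ S, (gridCube b i).rho σ ≠ ∞ → tentCoeff p μ σ b S i ≤
      N * ((2 ^ κ i)⁻¹ * e (κ i)) * ν (gridCore b i) := by
    intro i hi ht
    have h1 : 2 ^ κ i * ENNReal.ofReal (ε (2 ^ κ i)) ≤ (gridCube b i).rhoEps σ ε := by
      rw [Cube.rhoEps, if_neg ht]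
      refine mul_le_mul' (hκ1 i hi ht) (ENNReal.ofReal_le_ofReal ?_)
      have h2 : (2 : ℝ) ^ κ i ≤ ((gridCube b i).rho σ).toReal := by
        have := ENNReal.toReal_mono ht (hκ1 i hi ht)
        simpa using this
      have h3 : (1 : ℝ) ≤ 2 ^ κ i := one_le_pow₀ one_le_two
      exact hε.mono (show (1 / 2 : ℝ) ≤ _ by linarith) (show (1 / 2 : ℝ) ≤ _ by linarith) h2
    -- Positivity of `ε` at `2 ^ k` comes from the convergence of the series of reciprocals.
    have h4 : ENNReal.ofReal (ε (2 ^ κ i)) ≠ 0 := fun h => he_top (κ i) (by simp [he, h])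
    have h5 : (gridCube b i).rhoEps σ ε ≠ 0 := fun h => by
      rw [h, nonpos_iff_eq_zero, mul_eq_zero] at h1
      rcases h1 with h1 | h1
      · exact pow_ne_zero _ (by simp) h1
      · exact h4 h1
    refine (tentCoeff_le_entropy hp le_rfl hN h5).trans ?_
    gcongr
    rw [he]
    dsimp only
    rw [← ENNReal.mul_inv (Or.inr ENNReal.ofReal_ne_top) (Or.inr h4)]
    exact ENNReal.inv_le_inv.2 h1
  have hzero : ∀ i ∈ S, ¬ (gridCube b i).rho σ ≠ ∞ → X i ^ p * tentCoeff p μ σ b S i = 0 := by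
    intro i hi ht
    push Not at ht
    have h1 : (gridCube b i).rhoEps σ ε = ∞ := by rw [Cube.rhoEps, if_pos ht]
    have h2 := tentCoeff_le_entropy (b := b) (S := S) (i := i) hp (le_refl (entropyConst p μ σ ε))
      hN (by rw [h1]; simp)
    rw [h1, ENNReal.inv_top, mul_zero, zero_mul, nonpos_iff_eq_zero] at h2
    rw [h2, mul_zero]
  set S' := S.filter fun i => (gridCube b i).rho σ ≠ ∞ with hS'
  -- On the level `ρ ≤ 2 ^ (k + 1)` the masses themselves form a Carleson sequence with constant `2
  -- * 2 ^ (k + 1)`. The `2 ^ k` cancels against the coefficient bound and leaves the summable `e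
  -- k`.
  have hlev : ∀ k : ℕ, ∑ i ∈ S'.filter (fun i => κ i = k), X i ^ p * ν (gridCore b i) ≤
      embeddingConst p * (2 * 2 ^ (k + 1)) * F := by
    intro k
    have hmem : ∀ i ∈ S'.filter (fun i => κ i = k),
        i ∈ S ∧ (gridCube b i).rho σ ≠ ∞ ∧ κ i = k := by
      intro i hi
      simp only [hS', Finset.mem_filter] at hi
      exact ⟨hi.1.1, hi.1.2, hi.2⟩
    refine carleson_embedding hp (isLaminar_gridCube hn b)
      (fun i => (gridCube b i).measurableSet_core) hf hfp _
      (fun i hi => hS0 i (hmem i hi).1) (fun i _ => Cube.weightMeasure_core_ne_top _ hσ)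
      (fun i => ν (gridCore b i)) _ fun j hj G hG hGj => ?_
    obtain ⟨hjS, hjt, hjk⟩ := hmem j hj
    refine (sum_weightMeasure_le_rho hn hσ hS (hS0 j hjS) (fun i hi => (hmem i (hG hi)).1)
      hGj).trans ?_
    gcongr
    rw [← hjk]
    exact hκ2 j hjS hjt
  calc ∑ i ∈ S, X i ^ p * tentCoeff p μ σ b S i
      = ∑ i ∈ S', X i ^ p * tentCoeff p μ σ b S i := by
        rw [hS', Finset.sum_filter]
        refine Finset.sum_congr rfl fun i hi => ?_
        split_ifs with h
        · rfl
        · exact hzero i hi h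
    _ ≤ ∑ i ∈ S', X i ^ p * (N * ((2 ^ κ i)⁻¹ * e (κ i)) * ν (gridCore b i)) := by
        refine Finset.sum_le_sum fun i hi => ?_
        rw [hS', Finset.mem_filter] at hi
        exact mul_le_mul_right (hcoeff i hi.1 hi.2) _
    _ = ∑ k ∈ S'.image κ, ∑ i ∈ S'.filter (fun i => κ i = k),
          X i ^ p * (N * ((2 ^ κ i)⁻¹ * e (κ i)) * ν (gridCore b i)) :=
        (Finset.sum_fiberwise_of_maps_to (fun i hi => Finset.mem_image_of_mem κ hi) _).symm
    _ = ∑ k ∈ S'.image κ, N * ((2 ^ k)⁻¹ * e k) *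
          ∑ i ∈ S'.filter (fun i => κ i = k), X i ^ p * ν (gridCore b i) := by
        refine Finset.sum_congr rfl fun k _ => ?_
        rw [Finset.mul_sum]
        refine Finset.sum_congr rfl fun i hi => ?_
        rw [(Finset.mem_filter.1 hi).2]; ring
    _ ≤ ∑ k ∈ S'.image κ, N * ((2 ^ k)⁻¹ * e k) * (embeddingConst p * (2 * 2 ^ (k + 1)) * F) :=
        Finset.sum_le_sum fun k _ => mul_le_mul_right (hlev k) _
    _ = ∑ k ∈ S'.image κ, embeddingConst p * (4 * N) * F * e k := by
        refine Finset.sum_congr rfl fun k _ => ?_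
        have : ((2 : ℝ≥0∞) ^ k)⁻¹ * 2 ^ k = 1 :=
          ENNReal.inv_mul_cancel (pow_ne_zero _ (by simp)) (ENNReal.pow_ne_top (by simp))
        calc N * ((2 ^ k)⁻¹ * e k) * (embeddingConst p * (2 * 2 ^ (k + 1)) * F)
            = embeddingConst p * (4 * N) * F * e k * ((2 ^ k)⁻¹ * 2 ^ k) := by
              rw [pow_succ]; ring
          _ = _ := by rw [this, mul_one]
    _ = embeddingConst p * (4 * N) * F * ∑ k ∈ S'.image κ, e k := by rw [Finset.mul_sum]
    _ ≤ embeddingConst p * (4 * N) * F * 2 := by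
        gcongr
        exact (ENNReal.sum_le_tsum _).trans hsum
    _ = _ := by ring

end Carleson

end PoissonCarleson

namespace PoissonCarleson

variable {n : ℕ}

/-! ### Dyadic maximal functions on the half-space -/

section DyadicMax

variable {p : ℝ} {μ : Measure (HalfSpace n)} {σ : Space n → ℝ≥0} {b : Fin n → Bool}

/-- The density of a measure on a dyadic cube. -/
noncomputable def gridAverage (κ : Measure (Space n)) (b : Fin n → Bool) (i : GridIndex n) :
    ℝ≥0∞ := κ (gridCore b i) / volume (gridCore b i)

/-- The dyadic maximal function of a measure over a finite family of cubes. -/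
noncomputable def finiteMax (κ : Measure (Space n)) (b : Fin n → Bool) (F : Finset (GridIndex n))
    (z : HalfSpace n) : ℝ≥0∞ :=
  ⨆ i ∈ F, (gridTent b i).indicator (fun _ => gridAverage κ b i) z

/-- The dyadic maximal function of a measure. -/
noncomputable def dyadicMax (κ : Measure (Space n)) (b : Fin n → Bool) (z : HalfSpace n) : ℝ≥0∞ :=
  ⨆ i, (gridTent b i).indicator (fun _ => gridAverage κ b i) z

theorem measurable_finiteMax (κ : Measure (Space n)) (b : Fin n → Bool)
    (F : Finset (GridIndex n)) : Measurable (finiteMax κ b F) :=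
  Measurable.biSup (F : Set (GridIndex n)) F.countable_toSet fun i _ =>
    measurable_const.indicator (gridCube b i).measurableSet_coreTilde

theorem measurable_dyadicMax (κ : Measure (Space n)) (b : Fin n → Bool) :
    Measurable (dyadicMax κ b) :=
  Measurable.iSup fun i => measurable_const.indicator (gridCube b i).measurableSet_coreTilde

theorem dyadicMax_eq_iSup (κ : Measure (Space n)) (b : Fin n → Bool) (z : HalfSpace n) :
    dyadicMax κ b z = ⨆ F, finiteMax κ b F z := iSup_eq_iSup_finset _

theorem finiteMax_mono (κ : Measure (Space n)) (b : Fin n → Bool) {F F' : Finset (GridIndex n)}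
    (h : F ⊆ F') (z : HalfSpace n) : finiteMax κ b F z ≤ finiteMax κ b F' z :=
  biSup_mono fun _ hi => h hi

/-- Linearization: at each point the maximal function is at most twice the average over the
principal cube whose residual tent contains the point. -/
theorem lintegral_finiteMax_le (hn : 1 ≤ n) (hp : 1 < p) (hσ : IsWeight σ) {f : Space n → ℝ≥0∞}
    (hf : AEMeasurable f (weightMeasure σ)) (hfp : ∫⁻ x, f x ^ p ∂weightMeasure σ ≠ ∞)
    {B : ℝ≥0∞} (hB : ∀ S : Finset (GridIndex n), IsSparse b S →
      (∀ i ∈ S, weightMeasure σ (gridCore b i) ≠ 0) →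
      ∑ i ∈ S, ((∫⁻ x in gridCore b i, f x ∂weightMeasure σ) /
        weightMeasure σ (gridCore b i)) ^ p * tentCoeff p μ σ b S i ≤ B)
    (F : Finset (GridIndex n)) :
    ∫⁻ z, finiteMax ((weightMeasure σ).withDensity f) b F z ^ p ∂μ ≤ 2 ^ p * B := by
  classical
  have hp0 : 0 < p := by linarith
  set ν := weightMeasure σ with hν
  set κ := ν.withDensity f with hκ
  set a := gridAverage κ b with ha
  have hlam := isLaminar_gridCube hn b
  have hcore : ∀ i, MeasurableSet (gridCore b i) := fun i => (gridCube b i).measurableSet_core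
  have htent : ∀ i, MeasurableSet (gridTent b i) := fun i => (gridCube b i).measurableSet_coreTilde
  have hκi : ∀ i, κ (gridCore b i) = ∫⁻ x in gridCore b i, f x ∂ν := fun i =>
    withDensity_apply _ (hcore i)
  have hνt : ∀ i, ν (gridCore b i) ≠ ∞ := fun i => Cube.weightMeasure_core_ne_top _ hσ
  have hat : ∀ i, a i ≠ ∞ := fun i => ENNReal.div_ne_top
    (by rw [hκi]; exact setLIntegral_ne_top_of_rpow hp hf hfp (hνt i)) (Cube.volume_core_ne_zero _)
  -- Cubes with zero average contribute nothing, and are dropped because the proof of sparseness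
  -- divides by the averages.
  obtain ⟨S, hSF, hcov, hprin⟩ := exists_principal (gridCore b) a (F.filter fun i => a i ≠ 0)
  have ha0 : ∀ i ∈ S, a i ≠ 0 := fun i hi => (Finset.mem_filter.1 (hSF hi)).2
  have hν0 : ∀ i ∈ S, ν (gridCore b i) ≠ 0 := by
    intro i hi h
    refine ha0 i hi ?_
    rw [ha, gridAverage, withDensity_absolutelyContinuous ν f h, ENNReal.zero_div]
  have hS : IsSparse b S := fun i hi => measure_le_two_mul_residual hlam hcore (κ := κ) (a := a)
    (fun i _ => ENNReal.div_mul_cancel (Cube.volume_core_ne_zero _) (Cube.volume_core_ne_top _))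
    ha0 (fun i _ => hat i) (fun i _ => Cube.volume_core_ne_top _) hprin i hi
  set h : HalfSpace n → ℝ≥0∞ := fun z =>
    ∑ i ∈ S, (residual (gridCore b) (gridTent b) S i).indicator (fun _ => a i ^ p) z with hh
  have hpt : ∀ z, finiteMax κ b F z ^ p ≤ 2 ^ p * h z := by
    intro z
    have h1 : finiteMax κ b F z ≤ 2 * h z ^ (1 / p) := by
      refine iSup₂_le fun i hi => ?_
      by_cases hz : z ∈ gridTent b i
      swap
      · rw [indicator_of_notMem hz]; exact zero_le
      rw [indicator_of_mem hz]
      by_cases hi0 : a i = 0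
      · rw [show gridAverage κ b i = 0 from hi0]; exact zero_le
      obtain ⟨j, hj, hij, haij⟩ := hcov i (Finset.mem_filter.2 ⟨hi, hi0⟩)
      obtain ⟨k, hk, hkj, hzk⟩ := exists_mem_residual hlam (E := gridTent b)
        (fun _ _ h => Cube.disjoint_coreTilde h) hj
        (Cube.coreTilde_subset_of_core_subset hn hij hz)
      -- The residual tent containing `z` may belong to a smaller principal cube; its average is
      -- only larger.
      have hajk : a j ≤ a k := by
        by_cases hkj' : k = j
        · rw [hkj']
        have hss : gridCore b k ⊂ gridCore b j := hkj.ssubset_of_ne fun he =>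
          hkj' (gridCube_injective hn b he)
        refine le_trans ?_ (hprin k hk j hj hss).le
        rw [two_mul]; exact le_self_add
      refine haij.trans (mul_le_mul_right (hajk.trans ?_) _)
      rw [one_div, ENNReal.le_rpow_inv_iff hp0]
      refine le_trans (le_of_eq ?_) (Finset.single_le_sum (f := fun i =>
        (residual (gridCore b) (gridTent b) S i).indicator (fun _ => a i ^ p) z)
        (fun _ _ => zero_le) hk)
      rw [indicator_of_mem hzk]
    calc finiteMax κ b F z ^ p ≤ (2 * h z ^ (1 / p)) ^ p := by gcongr
      _ = 2 ^ p * h z := by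
        rw [ENNReal.mul_rpow_of_nonneg _ _ hp0.le, ← ENNReal.rpow_mul, one_div_mul_cancel hp0.ne',
          ENNReal.rpow_one]
  have hres := measurableSet_residual (gridCore b) htent S
  calc ∫⁻ z, finiteMax κ b F z ^ p ∂μ ≤ ∫⁻ z, 2 ^ p * h z ∂μ := lintegral_mono hpt
    _ = 2 ^ p * ∑ i ∈ S, a i ^ p * μ (residual (gridCore b) (gridTent b) S i) := by
      rw [lintegral_const_mul' _ _ (ENNReal.rpow_ne_top_of_nonneg hp0.le (by simp)), hh,
        lintegral_finsetSum _ fun i _ => measurable_const.indicator (hres i)]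
      congr 1
      exact Finset.sum_congr rfl fun i _ => by rw [lintegral_indicator_const (hres i)]
    _ ≤ 2 ^ p * B := by
      refine mul_le_mul_right (le_trans (le_of_eq ?_) (hB S hS hν0)) _
      refine Finset.sum_congr rfl fun i hi => ?_
      rw [tentCoeff, ← mul_assoc, ← ENNReal.mul_rpow_of_nonneg _ _ hp0.le, ← hκi]
      congr 2
      rw [ha, gridAverage, ← mul_div_assoc, ENNReal.div_mul_cancel (hν0 i hi) (hνt i)]

theorem lintegral_dyadicMax_le (hn : 1 ≤ n) (hp : 1 < p) (hσ : IsWeight σ) {f : Space n → ℝ≥0∞}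
    (hf : AEMeasurable f (weightMeasure σ)) (hfp : ∫⁻ x, f x ^ p ∂weightMeasure σ ≠ ∞)
    {B : ℝ≥0∞} (hB : ∀ S : Finset (GridIndex n), IsSparse b S →
      (∀ i ∈ S, weightMeasure σ (gridCore b i) ≠ 0) →
      ∑ i ∈ S, ((∫⁻ x in gridCore b i, f x ∂weightMeasure σ) /
        weightMeasure σ (gridCore b i)) ^ p * tentCoeff p μ σ b S i ≤ B) :
    ∫⁻ z, dyadicMax ((weightMeasure σ).withDensity f) b z ^ p ∂μ ≤ 2 ^ p * B := by
  have hp0 : 0 < p := by linarith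
  set κ := (weightMeasure σ).withDensity f
  have h1 : ∀ z, dyadicMax κ b z ^ p = ⨆ F, finiteMax κ b F z ^ p := by
    intro z
    rw [dyadicMax_eq_iSup]
    exact (ENNReal.orderIsoRpow p hp0).map_iSup _
  simp_rw [h1]
  rw [lintegral_iSup_directed fun F => ((measurable_finiteMax κ b F).pow_const p).aemeasurable]
  · exact iSup_le fun F => lintegral_finiteMax_le hn hp hσ hf hfp hB F
  · refine Monotone.directed_le fun F F' hFF' z => ?_
    have := finiteMax_mono κ b hFF' z
    dsimp only
    gcongr

/-- On a cube with average above `a`, Hölder's inequality compares `a ^ p • μ` on the tent with `f ^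
p σ` on the cube; laminarity extends the comparison to the union. -/
theorem rpow_mul_measure_finiteMax_le (hn : 1 ≤ n) (hp : 1 < p)
    {f : Space n → ℝ≥0∞} (hf : AEMeasurable f (weightMeasure σ)) (F : Finset (GridIndex n))
    (a : ℝ≥0∞) :
    a ^ p * μ {z | a < finiteMax ((weightMeasure σ).withDensity f) b F z} ≤
      apConst p μ σ * ∫⁻ x, f x ^ p ∂weightMeasure σ := by
  classical
  have hp0 : 0 < p := by linarith
  set ν := weightMeasure σ with hν
  set κ := ν.withDensity f with hκ
  have hcore : ∀ i, MeasurableSet (gridCore b i) := fun i => (gridCube b i).measurableSet_core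
  have hset : {z | a < finiteMax κ b F z} ⊆
      ⋃ i ∈ F.filter (fun i => a < gridAverage κ b i), gridTent b i := by
    intro z hz
    simp only [mem_ofPred_eq, finiteMax, lt_iSup_iff] at hz
    obtain ⟨i, hi, hz⟩ := hz
    by_cases hzi : z ∈ gridTent b i
    · rw [indicator_of_mem hzi] at hz
      exact mem_biUnion (Finset.mem_coe.2 (Finset.mem_filter.2 ⟨hi, hz⟩)) hzi
    · rw [indicator_of_notMem hzi] at hz
      exact absurd hz not_lt_zero
  have hmain := measure_biUnion_le_of_isLaminar (isLaminar_gridCube hn b) hcore (E := gridTent b)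
    (fun i j h => Cube.coreTilde_subset_of_core_subset hn h) (a ^ p • μ)
    (apConst p μ σ • ν.withDensity fun x => f x ^ p)
    (F.filter fun i => a < gridAverage κ b i) fun i hi => by
      have hai := (Finset.mem_filter.1 hi).2.le
      rw [Measure.smul_apply, Measure.smul_apply, smul_eq_mul, smul_eq_mul,
        withDensity_apply _ (hcore i)]
      set V := volume (gridCore b i) with hV
      have hap : μ (gridTent b i) / V * (ν (gridCore b i) / V) ^ (p - 1) ≤ apConst p μ σ := by
        have h := le_iSup (fun Q : Cube n =>
          μ Q.tilde / volume Q.toSet * (Q.mass σ / volume Q.toSet) ^ (p - 1)) (gridCube b i)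
        rw [Cube.volume_toSet_eq, Cube.mass_eq] at h
        refine le_trans ?_ h
        gcongr
        exact Cube.coreTilde_subset_tilde _
      have hJ := lintegral_rpow_le_measure_mul hp hf (gridCore b i)
      calc a ^ p * μ (gridTent b i) ≤ gridAverage κ b i ^ p * μ (gridTent b i) := by gcongr
        _ = (∫⁻ x in gridCore b i, f x ∂ν) ^ p * V⁻¹ ^ p * μ (gridTent b i) := by
          rw [gridAverage, hκ, withDensity_apply _ (hcore i), div_eq_mul_inv,
            ENNReal.mul_rpow_of_nonneg _ _ hp0.le]
        _ ≤ (ν (gridCore b i) ^ (p - 1) * ∫⁻ x in gridCore b i, f x ^ p ∂ν) * V⁻¹ ^ p *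
            μ (gridTent b i) := by gcongr
        _ = (μ (gridTent b i) / V * (ν (gridCore b i) / V) ^ (p - 1)) *
            ∫⁻ x in gridCore b i, f x ^ p ∂ν := by
          have e : V⁻¹ ^ p = V⁻¹ * V⁻¹ ^ (p - 1) := by
            calc V⁻¹ ^ p = V⁻¹ ^ (1 + (p - 1)) := by congr 1; ring
              _ = _ := by
                rw [ENNReal.rpow_add_of_nonneg _ _ zero_le_one (by linarith), ENNReal.rpow_one]
          rw [e, div_eq_mul_inv, div_eq_mul_inv (ν (gridCore b i)),
            ENNReal.mul_rpow_of_nonneg _ _ (by linarith)]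
          ring
        _ ≤ _ := by gcongr
  calc a ^ p * μ {z | a < finiteMax κ b F z}
      ≤ (a ^ p • μ) (⋃ i ∈ F.filter (fun i => a < gridAverage κ b i), gridTent b i) := by
        rw [Measure.smul_apply, smul_eq_mul]
        gcongr
    _ ≤ _ := hmain
    _ ≤ (apConst p μ σ • ν.withDensity fun x => f x ^ p) univ := measure_mono (subset_univ _)
    _ = _ := by
      rw [Measure.smul_apply, smul_eq_mul, withDensity_apply _ MeasurableSet.univ,
        Measure.restrict_univ]

theorem rpow_mul_measure_dyadicMax_le (hn : 1 ≤ n) (hp : 1 < p)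
    {f : Space n → ℝ≥0∞} (hf : AEMeasurable f (weightMeasure σ)) (a : ℝ≥0∞) :
    a ^ p * μ {z | a < dyadicMax ((weightMeasure σ).withDensity f) b z} ≤
      apConst p μ σ * ∫⁻ x, f x ^ p ∂weightMeasure σ := by
  set κ := (weightMeasure σ).withDensity f
  have h1 : {z | a < dyadicMax κ b z} = ⋃ F, {z | a < finiteMax κ b F z} := by
    ext z
    simp only [mem_ofPred_eq, mem_iUnion, dyadicMax_eq_iSup, lt_iSup_iff]
  have h2 : Directed (· ⊆ ·) fun F => {z | a < finiteMax κ b F z} :=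
    Monotone.directed_le fun F F' hFF' z hz => lt_of_lt_of_le hz (finiteMax_mono κ b hFF' z)
  rw [h1, h2.measure_iUnion, ENNReal.mul_iSup]
  exact iSup_le fun F => rpow_mul_measure_finiteMax_le hn hp hf F a

/-- The sum of the dyadic maximal functions of the shifted grids. -/
noncomputable def gridMax (κ : Measure (Space n)) (z : HalfSpace n) : ℝ≥0∞ :=
  ∑ b : Fin n → Bool, dyadicMax κ b z

theorem measurable_gridMax (κ : Measure (Space n)) : Measurable (gridMax κ) :=
  Finset.measurable_fun_sum _ fun b _ => measurable_dyadicMax κ b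

end DyadicMax

end PoissonCarleson

namespace PoissonCarleson

variable {n : ℕ}

/-! ### Operator norms -/

section OpNorm

variable {p : ℝ} {μ : Measure (HalfSpace n)} {σ : Space n → ℝ≥0} {f : Space n → ℂ}

theorem measurable_poissonKernel :
    Measurable fun w : HalfSpace n × Space n => poissonKernel (w.1.1 - w.2) w.1.2 := by
  simp only [poissonKernel_eq]
  fun_prop

theorem aestronglyMeasurable_smul_weight (hσ : IsWeight σ)
    (hf : AEStronglyMeasurable f (weightMeasure σ)) :
    AEStronglyMeasurable (fun y => σ y • f y) volume := by
  have hm := hσ.aemeasurable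
  -- The weight is only almost everywhere measurable, so a measurable version replaces it.
  obtain ⟨s, hs, hσs⟩ := hm
  have h1 : weightMeasure σ = volume.withDensity fun x => (s x : ℝ≥0∞) :=
    withDensity_congr_ae (by filter_upwards [hσs] with x hx; rw [hx])
  rw [h1, aestronglyMeasurable_withDensity_iff hs] at hf
  refine hf.congr ?_
  filter_upwards [hσs] with x hx
  rw [hx]; rfl

theorem aestronglyMeasurable_poissonIntegral {g : Space n → ℂ}
    (hg : AEStronglyMeasurable g volume) (μ : Measure (HalfSpace n)) :
    AEStronglyMeasurable (poissonIntegral g) μ := by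
  have h1 : poissonIntegral g = poissonIntegral (hg.mk g) := by
    funext z
    exact integral_congr_ae (hg.ae_eq_mk.mono fun y hy => by simp only [hy])
  rw [h1]
  refine (StronglyMeasurable.integral_prod_right (ν := (volume : Measure (Space n)))
    (f := fun (z : HalfSpace n) (y : Space n) => poissonKernel (z.1 - y) z.2 • hg.mk g y)
    ?_).aestronglyMeasurable
  exact (measurable_poissonKernel.stronglyMeasurable).smul
    (hg.stronglyMeasurable_mk.comp_measurable measurable_snd)

theorem lintegral_poissonKernel_smul (g : Space n → ℂ) (z : HalfSpace n) :
    ∫⁻ y, ‖poissonKernel (z.1 - y) z.2 • g y‖ₑ =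
      ∫⁻ y, ENNReal.ofReal (poissonKernel (z.1 - y) z.2) * ‖g y‖ₑ := by
  refine lintegral_congr fun y => ?_
  rw [enorm_smul, Real.enorm_of_nonneg (poissonKernel_nonneg _ _)]

theorem setLIntegral_enorm_smul_weight (hσ : IsWeight σ)
    (hf : AEStronglyMeasurable f (weightMeasure σ)) (Q : Cube n) :
    ∫⁻ y in Q.core, ‖σ y • f y‖ₑ =
      ((weightMeasure σ).withDensity fun y => ‖f y‖ₑ) Q.core := by
  have hm : AEMeasurable (fun y => (σ y : ℝ≥0∞)) volume := hσ.aemeasurable.coe_nnreal_ennreal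
  have hf' : AEMeasurable (fun y => ‖f y‖ₑ)
      ((volume.restrict Q.core).withDensity fun y => (σ y : ℝ≥0∞)) := by
    rw [← restrict_withDensity Q.measurableSet_core]
    exact hf.enorm.restrict
  rw [withDensity_apply _ Q.measurableSet_core, weightMeasure,
    restrict_withDensity Q.measurableSet_core,
    lintegral_withDensity_eq_lintegral_mul₀' hm.restrict hf']
  refine lintegral_congr fun y => ?_
  rw [Pi.mul_apply, NNReal.smul_def, enorm_smul]
  simp

/-- The Poisson integral of the absolute value is dominated by the dyadic maximal functions. -/
theorem exists_lintegral_poisson_le_gridMax (n : ℕ) : ∃ C : ℝ≥0, C ≠ 0 ∧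
    ∀ {σ : Space n → ℝ≥0}, IsWeight σ → ∀ {f : Space n → ℂ},
      AEStronglyMeasurable f (weightMeasure σ) → ∀ z : HalfSpace n,
      ∫⁻ y, ‖poissonKernel (z.1 - y) z.2 • (σ y • f y)‖ₑ ≤
        C * gridMax ((weightMeasure σ).withDensity fun y => ‖f y‖ₑ) z := by
  obtain ⟨C, hC⟩ := exists_lintegral_poissonKernel_le n
  -- The added one keeps the constant nonzero, so that a finite bound `C * A ^ (1 / p)` later
  -- implies that `A` is finite.
  refine ⟨C + 1, by positivity, @fun σ hσ f hf z => ?_⟩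
  rw [lintegral_poissonKernel_smul]
  refine (hC _ (aestronglyMeasurable_smul_weight hσ hf).enorm z _ fun b i hz => ?_).trans
    (mul_le_mul_left (ENNReal.coe_le_coe.2 le_self_add) _)
  rw [setLIntegral_enorm_smul_weight hσ hf]
  refine le_trans ?_ (Finset.single_le_sum (f := fun b => dyadicMax _ b z)
    (fun _ _ => zero_le) (Finset.mem_univ b))
  refine le_iSup_of_le i ?_
  rw [indicator_of_mem hz]
  rfl

/-- Measurability and absolute convergence are settled here once, the latter from the finiteness of
the dyadic maximal functions. An infinite bound needs no proof. -/
theorem poissonOpNorm_le (hσ : IsWeight σ) {N : (HalfSpace n → ℂ) → ℝ≥0∞} {K : ℝ≥0∞}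
    (h : K ≠ ∞ → ∀ f : Space n → ℂ, MemLp f (ENNReal.ofReal p) (weightMeasure σ) →
      (∀ᵐ z ∂μ, gridMax ((weightMeasure σ).withDensity fun y => ‖f y‖ₑ) z < ∞) ∧
      N (poissonIntegral fun y => σ y • f y) ≤
        K * eLpNorm f (ENNReal.ofReal p) (weightMeasure σ)) :
    poissonOpNorm p μ σ N ≤ K := by
  by_cases hK : K = ∞
  · rw [hK]; exact le_top
  refine sInf_le fun f hf => ?_
  obtain ⟨h1, h2⟩ := h hK f hf
  have hg := aestronglyMeasurable_smul_weight hσ hf.1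
  refine ⟨?_, aestronglyMeasurable_poissonIntegral hg μ, h2⟩
  obtain ⟨C, -, hC⟩ := exists_lintegral_poisson_le_gridMax n
  filter_upwards [h1] with z hz
  refine ⟨?_, lt_of_le_of_lt (hC hσ hf.1 z) (ENNReal.mul_lt_top ENNReal.coe_lt_top hz)⟩
  have hk : Measurable fun y => poissonKernel (z.1 - y) z.2 :=
    measurable_poissonKernel.comp (measurable_const.prodMk measurable_id)
  exact hk.aestronglyMeasurable.smul hg

theorem eLpNorm_ofReal_eq (hp : 1 < p) {X : Type*} [MeasurableSpace X] (ν : Measure X)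
    (g : X → ℂ) : eLpNorm g (ENNReal.ofReal p) ν = (∫⁻ x, ‖g x‖ₑ ^ p ∂ν) ^ (1 / p) := by
  have hp0 : 0 < p := by linarith
  rw [eLpNorm_eq_lintegral_rpow_enorm_toReal (by simpa using hp0) ENNReal.ofReal_ne_top,
    ENNReal.toReal_ofReal hp0.le]

theorem lintegral_enorm_rpow_ne_top (hp : 1 < p) {X : Type*} [MeasurableSpace X] {ν : Measure X}
    {g : X → ℂ} (hg : MemLp g (ENNReal.ofReal p) ν) : ∫⁻ x, ‖g x‖ₑ ^ p ∂ν ≠ ∞ := by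
  intro h
  have := hg.2
  rw [eLpNorm_ofReal_eq hp, h, ENNReal.top_rpow_of_pos (by positivity)] at this
  exact lt_irrefl _ this

/-- A uniform discretized estimate implies the strong type estimate. -/
theorem exists_poissonOpNorm_strong_le (hn : 1 ≤ n) (hp : 1 < p) : ∃ C : ℝ≥0, C ≠ 0 ∧
    ∀ (μ : Measure (HalfSpace n)) (σ : Space n → ℝ≥0), IsWeight σ → ∀ A : ℝ≥0∞,
      (A ≠ ∞ → ∀ f : Space n → ℝ≥0∞, AEMeasurable f (weightMeasure σ) →
        ∫⁻ x, f x ^ p ∂weightMeasure σ ≠ ∞ → ∀ (b : Fin n → Bool) (S : Finset (GridIndex n)),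
        IsSparse b S → (∀ i ∈ S, weightMeasure σ (gridCore b i) ≠ 0) →
        ∑ i ∈ S, ((∫⁻ x in gridCore b i, f x ∂weightMeasure σ) /
          weightMeasure σ (gridCore b i)) ^ p * tentCoeff p μ σ b S i ≤
          embeddingConst p * A * ∫⁻ x, f x ^ p ∂weightMeasure σ) →
      poissonOpNorm p μ σ (strongLpNorm p μ) ≤ C * A ^ (1 / p) := by
  have hp0 : 0 < p := by linarith
  obtain ⟨C, hC0, hC⟩ := exists_lintegral_poisson_le_gridMax n
  -- The number of grids; `m ^ (p - 1)` is the loss in taking the power `p` of a sum of `m` terms.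
  set m : ℝ≥0∞ := (((Finset.univ : Finset (Fin n → Bool)).card : ℕ) : ℝ≥0∞) with hm
  have hmt : m ≠ ∞ := ENNReal.natCast_ne_top _
  set L : ℝ≥0∞ := m ^ (p - 1) * (m * (2 ^ p * embeddingConst p)) with hL
  have hLt : L ≠ ∞ := ENNReal.mul_ne_top (ENNReal.rpow_ne_top_of_nonneg (by linarith) hmt)
    (ENNReal.mul_ne_top hmt (ENNReal.mul_ne_top (ENNReal.rpow_ne_top_of_nonneg hp0.le (by simp))
      (embeddingConst_ne_top hp)))
  set C' : ℝ≥0 := (C * L ^ (1 / p)).toNNReal + 1 with hC'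
  have hCC' : C * L ^ (1 / p) ≤ C' := by
    rw [hC', ENNReal.coe_add, ENNReal.coe_toNNReal]
    · exact le_self_add
    · exact ENNReal.mul_ne_top ENNReal.coe_ne_top
        (ENNReal.rpow_ne_top_of_nonneg (by positivity) hLt)
  refine ⟨C', by positivity, fun μ σ hσ A hA => poissonOpNorm_le hσ fun hK f hf => ?_⟩
  have hAt : A ≠ ∞ := by
    rintro rfl
    rw [ENNReal.top_rpow_of_pos (by positivity), ENNReal.mul_top (by positivity)] at hK
    exact hK rfl
  set F := ∫⁻ x, ‖f x‖ₑ ^ p ∂weightMeasure σ with hF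
  have hFt : F ≠ ∞ := lintegral_enorm_rpow_ne_top hp hf
  set κ := (weightMeasure σ).withDensity fun y => ‖f y‖ₑ with hκ
  have hmax : ∫⁻ z, gridMax κ z ^ p ∂μ ≤ L * (A * F) := by
    calc ∫⁻ z, gridMax κ z ^ p ∂μ
        ≤ ∫⁻ z, m ^ (p - 1) * ∑ b : Fin n → Bool, dyadicMax κ b z ^ p ∂μ :=
          lintegral_mono fun z => ENNReal.rpow_sum_le_const_mul_sum_rpow _ _ hp.le
      _ = m ^ (p - 1) * ∑ b : Fin n → Bool, ∫⁻ z, dyadicMax κ b z ^ p ∂μ := by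
          rw [lintegral_const_mul' _ _ (ENNReal.rpow_ne_top_of_nonneg (by linarith) hmt),
            lintegral_finsetSum _ fun b _ => (measurable_dyadicMax κ b).pow_const p]
      _ ≤ m ^ (p - 1) * ∑ b : Fin n → Bool, 2 ^ p * (embeddingConst p * A * F) := by
          gcongr with b
          exact lintegral_dyadicMax_le hn hp hσ hf.1.enorm hFt
            (hA hAt _ hf.1.enorm hFt b)
      _ = _ := by
          rw [Finset.sum_const, nsmul_eq_mul, hL]; ring
  constructor
  · have h1 : ∀ᵐ z ∂μ, gridMax κ z ^ p < ∞ :=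
      ae_lt_top ((measurable_gridMax κ).pow_const p) (ne_top_of_le_ne_top
        (ENNReal.mul_ne_top hLt (ENNReal.mul_ne_top hAt hFt)) hmax)
    filter_upwards [h1] with z hz
    exact (ENNReal.rpow_lt_top_iff_of_pos hp0).1 hz
  · rw [strongLpNorm, eLpNorm_ofReal_eq hp, eLpNorm_ofReal_eq hp, ← hF]
    calc (∫⁻ z, ‖poissonIntegral (fun y => σ y • f y) z‖ₑ ^ p ∂μ) ^ (1 / p)
        ≤ (∫⁻ z, (C : ℝ≥0∞) ^ p * gridMax κ z ^ p ∂μ) ^ (1 / p) := by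
          gcongr with z
          rw [← ENNReal.mul_rpow_of_nonneg _ _ hp0.le]
          gcongr
          exact (enorm_integral_le_lintegral_enorm _).trans (hC hσ hf.1 z)
      _ ≤ ((C : ℝ≥0∞) ^ p * (L * (A * F))) ^ (1 / p) := by
          rw [lintegral_const_mul' _ _ (ENNReal.rpow_ne_top_of_nonneg hp0.le ENNReal.coe_ne_top)]
          gcongr
      _ = C * L ^ (1 / p) * (A ^ (1 / p) * F ^ (1 / p)) := by
          have hq : 0 ≤ 1 / p := by positivity
          rw [ENNReal.mul_rpow_of_nonneg _ _ hq, ENNReal.mul_rpow_of_nonneg L _ hq,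
            ENNReal.mul_rpow_of_nonneg A F hq, ← ENNReal.rpow_mul, mul_one_div_cancel hp0.ne',
            ENNReal.rpow_one]
          ring
      _ ≤ C' * (A ^ (1 / p) * F ^ (1 / p)) := by gcongr
      _ = _ := by ring

/-- The weak type estimate. -/
theorem exists_poissonOpNorm_weak_le (hn : 1 ≤ n) (hp : 1 < p) : ∃ C : ℝ≥0,
    ∀ (μ : Measure (HalfSpace n)) (σ : Space n → ℝ≥0), IsWeight σ →
      poissonOpNorm p μ σ (weakLpNorm p μ) ≤ C * apConst p μ σ ^ (1 / p) := by
  have hp0 : 0 < p := by linarith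
  obtain ⟨C, hC0, hC⟩ := exists_lintegral_poisson_le_gridMax n
  set m : ℝ≥0 := (((Finset.univ : Finset (Fin n → Bool)).card : ℕ) : ℝ≥0) with hm
  have hm0 : m ≠ 0 := by
    rw [hm]
    exact_mod_cast (Finset.card_pos.2 Finset.univ_nonempty).ne'
  set C' : ℝ≥0 := C * m * m ^ (1 / p) with hC'
  have hC'0 : C' ≠ 0 := mul_ne_zero (mul_ne_zero hC0 hm0) (NNReal.rpow_pos (pos_iff_ne_zero.2 hm0)).ne'
  refine ⟨C', fun μ σ hσ => poissonOpNorm_le hσ fun hK f hf => ?_⟩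
  set A := apConst p μ σ with hA
  have hAt : A ≠ ∞ := by
    intro h
    rw [h, ENNReal.top_rpow_of_pos (by positivity), ENNReal.mul_top (by simpa using hC'0)] at hK
    exact hK rfl
  set F := ∫⁻ x, ‖f x‖ₑ ^ p ∂weightMeasure σ with hF
  have hFt : F ≠ ∞ := lintegral_enorm_rpow_ne_top hp hf
  set κ := (weightMeasure σ).withDensity fun y => ‖f y‖ₑ with hκ
  have hweak : ∀ (b : Fin n → Bool) (a : ℝ≥0∞), a ^ p * μ {z | a < dyadicMax κ b z} ≤ A * F :=
    fun b a => rpow_mul_measure_dyadicMax_le hn hp hf.1.enorm a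
  constructor
  · have h1 : ∀ b : Fin n → Bool, ∀ᵐ z ∂μ, dyadicMax κ b z < ∞ := by
      intro b
      rw [ae_iff]
      set E := {z | ¬ dyadicMax κ b z < ∞} with hE
      by_contra hne
      have hT : A * F / μ E ≠ ∞ := ENNReal.div_ne_top (ENNReal.mul_ne_top hAt hFt) hne
      -- The weak estimate at height `k ^ (1 / p)` gives `k * μ E ≤ A * F`, against the choice of
      -- `k`. Infinite `μ E` is treated apart, because the quotient is then zero.
      obtain ⟨k, hk⟩ := ENNReal.exists_nat_gt hT
      have hkt : ((k : ℝ≥0∞) ^ (1 / p)) ≠ ∞ :=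
        ENNReal.rpow_ne_top_of_nonneg (by positivity) (ENNReal.natCast_ne_top k)
      have h2 : (k : ℝ≥0∞) * μ E ≤ A * F := by
        refine le_trans ?_ (hweak b ((k : ℝ≥0∞) ^ (1 / p)))
        rw [← ENNReal.rpow_mul, one_div_mul_cancel hp0.ne', ENNReal.rpow_one]
        refine mul_le_mul_right (measure_mono fun z hz => ?_) _
        have : dyadicMax κ b z = ∞ := not_lt_top_iff.1 hz
        rw [mem_ofPred_eq, this]
        exact lt_top_iff_ne_top.2 hkt
      by_cases hEt : μ E = ∞
      · rw [hEt, ENNReal.div_top] at hk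
        rw [hEt, ENNReal.mul_top hk.ne', top_le_iff] at h2
        exact ENNReal.mul_ne_top hAt hFt h2
      · rw [ENNReal.div_lt_iff (Or.inl hne) (Or.inl hEt)] at hk
        exact absurd hk (not_lt.2 h2)
    filter_upwards [ae_all_iff.2 h1] with z hz
    exact ENNReal.sum_lt_top.2 fun b _ => hz b
  · rw [eLpNorm_ofReal_eq hp, ← hF]
    refine iSup_le fun a => ?_
    set G := fun z => poissonIntegral (fun y => σ y • f y) z with hG
    -- If all `m` dyadic maximal functions were at most `l`, the Poisson integral would be at most
    -- `a`.
    set l : ℝ≥0 := a / (C * m) with hl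
    have hal : a = C * m * l := by
      rw [hl, mul_div_cancel₀ _ (mul_ne_zero hC0 hm0)]
    have hsub : {z | (a : ℝ≥0∞) < ‖G z‖ₑ} ⊆
        ⋃ b ∈ (Finset.univ : Finset (Fin n → Bool)), {z | (l : ℝ≥0∞) < dyadicMax κ b z} := by
      intro z hz
      by_contra hcon
      simp only [Finset.mem_univ, iUnion_true, mem_iUnion, mem_ofPred_eq, not_exists,
        not_lt] at hcon
      have h1 : gridMax κ z ≤ m * l := by
        calc gridMax κ z ≤ ∑ _b : Fin n → Bool, (l : ℝ≥0∞) := Finset.sum_le_sum fun b _ => hcon b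
          _ = _ := by rw [Finset.sum_const, nsmul_eq_mul, hm]; simp
      have h2 : ‖G z‖ₑ ≤ a := by
        calc ‖G z‖ₑ ≤ C * gridMax κ z :=
              (enorm_integral_le_lintegral_enorm _).trans (hC hσ hf.1 z)
          _ ≤ C * (m * l) := by gcongr
          _ = a := by rw [hal]; push_cast; ring
      exact absurd hz (not_lt.2 h2)
    have hq : 0 ≤ 1 / p := by positivity
    have hlow : (l : ℝ≥0∞) ^ p * μ {z | (a : ℝ≥0∞) < ‖G z‖ₑ} ≤ m * (A * F) := by
      calc (l : ℝ≥0∞) ^ p * μ {z | (a : ℝ≥0∞) < ‖G z‖ₑ}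
          ≤ (l : ℝ≥0∞) ^ p * ∑ b : Fin n → Bool, μ {z | (l : ℝ≥0∞) < dyadicMax κ b z} :=
            mul_le_mul_right ((measure_mono hsub).trans (measure_biUnion_finset_le _ _)) _
        _ ≤ ∑ _b : Fin n → Bool, A * F := by
            rw [Finset.mul_sum]
            exact Finset.sum_le_sum fun b _ => hweak b l
        _ = _ := by rw [Finset.sum_const, nsmul_eq_mul, hm]; simp
    calc (a : ℝ≥0∞) * μ {z | (a : ℝ≥0∞) < ‖G z‖ₑ} ^ (1 / p)
        = C * m * ((l : ℝ≥0∞) ^ p * μ {z | (a : ℝ≥0∞) < ‖G z‖ₑ}) ^ (1 / p) := by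
          rw [ENNReal.mul_rpow_of_nonneg _ _ hq, ← ENNReal.rpow_mul, mul_one_div_cancel hp0.ne',
            ENNReal.rpow_one, ← mul_assoc]
          congr 1
          rw [hal]; push_cast; ring
      _ ≤ C * m * (m * (A * F)) ^ (1 / p) := by gcongr
      _ = _ := by
          rw [ENNReal.mul_rpow_of_nonneg _ _ hq, ENNReal.mul_rpow_of_nonneg _ _ hq, hC',
            ENNReal.coe_mul, ENNReal.coe_mul, ENNReal.coe_rpow_of_nonneg _ hq]
          ring

end OpNorm

end PoissonCarleson

/-! ### Assembly of the four estimates -/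

open PoissonCarleson

theorem mainTheorem5 (n : ℕ) (hn : 1 ≤ n) (p : ℝ) (hp : 1 < p) :
    ∃ C : ℝ≥0, ∀ (μ : Measure (HalfSpace n)) (σ : Space n → ℝ≥0), IsWeight σ →
      poissonOpNorm p μ σ (weakLpNorm p μ) ≤ C * apConst p μ σ ^ (1 / p) ∧
      poissonOpNorm p μ σ (strongLpNorm p μ) ≤ C * spConst p μ σ ∧
      (∀ (Φ : ℝ≥0 → ℝ≥0) (Ψ : ℝ≥0 → ℝ≥0∞), IsYoung Φ → IsComplementary Φ Ψ →
        poissonOpNorm p μ σ (strongLpNorm p μ) ≤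
          C * (bumpConst p μ σ (fun s => (Φ s : ℝ≥0∞)) * wpConst p σ Ψ) ^ (1 / p)) ∧
      (∀ ε : ℝ → ℝ, IsEntropyFunction ε →
        poissonOpNorm p μ σ (strongLpNorm p μ) ≤ C * entropyConst p μ σ ε ^ (1 / p)) := by
  have hp0 : 0 < p := by linarith
  have hq : 0 ≤ 1 / p := by positivity
  obtain ⟨C₁, hC₁⟩ := exists_poissonOpNorm_weak_le hn hp
  obtain ⟨C₂, -, hC₂⟩ := exists_poissonOpNorm_strong_le hn hp
  -- The `p`-th roots of the numerical factors in the Carleson conditions for the bump and entropy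
  -- constants.
  set c₃ : ℝ≥0 := (4 ^ p * 2) ^ (1 / p) with hc₃
  set c₄ : ℝ≥0 := 8 ^ (1 / p) with hc₄
  have e₃ : (c₃ : ℝ≥0∞) = (4 ^ p * 2) ^ (1 / p) := by
    rw [hc₃, ENNReal.coe_rpow_of_nonneg _ hq, ENNReal.coe_mul, ENNReal.coe_rpow_of_nonneg _ hp0.le]
    norm_num
  have e₄ : (c₄ : ℝ≥0∞) = 8 ^ (1 / p) := by
    rw [hc₄, ENNReal.coe_rpow_of_nonneg _ hq]
    norm_num
  have hcore : ∀ (b : Fin n → Bool) i, MeasurableSet (gridCore b i) :=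
    fun b i => (gridCube b i).measurableSet_core
  set C : ℝ≥0 := C₁ + C₂ * (1 + c₃ + c₄) with hC
  have le₁ : C₁ ≤ C := le_self_add
  have le₂ : C₂ ≤ C := calc
    C₂ = C₂ * 1 := (mul_one _).symm
    _ ≤ C₂ * (1 + c₃ + c₄) := by gcongr; rw [add_assoc]; exact le_self_add
    _ ≤ C := le_add_self
  have le₃ : C₂ * c₃ ≤ C := calc
    C₂ * c₃ ≤ C₂ * (1 + c₃ + c₄) := by gcongr; exact le_add_self.trans le_self_add
    _ ≤ C := le_add_self
  have le₄ : C₂ * c₄ ≤ C := calc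
    C₂ * c₄ ≤ C₂ * (1 + c₃ + c₄) := by gcongr; exact le_add_self
    _ ≤ C := le_add_self
  refine ⟨C, fun μ σ hσ => ⟨?_, ?_, fun Φ Ψ hΦ hΨ => ?_, fun ε hε => ?_⟩⟩
  · exact (hC₁ μ σ hσ).trans (mul_le_mul_left (ENNReal.coe_le_coe.2 le₁) _)
  -- The testing constant already contains a `p`-th root, so its `p`-th power is the Carleson
  -- constant.
  · refine (hC₂ μ σ hσ (spConst p μ σ ^ p) fun _ f hf hfp b S hS hS0 => ?_).trans ?_
    · exact carleson_embedding hp (isLaminar_gridCube hn b) (hcore b) hf hfp S hS0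
        (fun i _ => Cube.weightMeasure_core_ne_top _ hσ) _ _ fun j hj G hG hGj =>
          sum_tentCoeff_le_testing hn hp hσ (hS0 j hj) hG hGj
    · rw [← ENNReal.rpow_mul, mul_one_div_cancel hp0.ne', ENNReal.rpow_one]
      exact mul_le_mul_left (ENNReal.coe_le_coe.2 le₂) _
  · refine (hC₂ μ σ hσ (4 ^ p * 2 * (bumpConst p μ σ (fun s => (Φ s : ℝ≥0∞)) * wpConst p σ Ψ))
      fun _ f hf hfp b S hS hS0 => ?_).trans ?_
    · exact carleson_embedding hp (isLaminar_gridCube hn b) (hcore b) hf hfp S hS0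
        (fun i _ => Cube.weightMeasure_core_ne_top _ hσ) _ _ fun j hj G hG hGj =>
          sum_tentCoeff_le_bump hn hp hσ hΦ hΨ hS (hS0 j hj) hG hGj
    · rw [ENNReal.mul_rpow_of_nonneg _ _ hq, ← e₃, ← mul_assoc, ← ENNReal.coe_mul]
      exact mul_le_mul_left (ENNReal.coe_le_coe.2 le₃) _
  · refine (hC₂ μ σ hσ (8 * entropyConst p μ σ ε) fun hA f hf hfp b S hS hS0 => ?_).trans ?_
    · refine sum_average_mul_tentCoeff_le_entropy hn hp hσ hε (fun h => hA ?_) hS hS0 hf hfp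
      rw [h, ENNReal.mul_top (by simp)]
    · rw [ENNReal.mul_rpow_of_nonneg _ _ hq, ← e₄, ← mul_assoc, ← ENNReal.coe_mul]
      exact mul_le_mul_left (ENNReal.coe_le_coe.2 le₄) _
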